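/- Let $d > 4$ be an integer, $r > 4$ a real number and $M_r \ge 0$. There is a constant $C > 0$, depending only on $d$, $r$ and $M_r$, such that the following holds. Let $P, Q$ be Borel probability measures on $\mathbb{R}^d$ with $\int \|x\|_2^r\,dP(x) \le M_r^r$ and $\int \|x\|_2^r\,dQ(x) \le M_r^r$, and suppose that $P$ is non-atomic (that is, $P(\{x\}) = 0$ for every $x\in\mathbb{R}^d$). Let $n, m \ge 1$, let $X_1,\dots,X_n$ be i.i.d. with law $P$ and $Y_1,\dots,Y_m$ i.i.d. with law $Q$ on a common probability space, and let $P_n = \frac1n\sum_{i=1}^n \delta_{X_i}$ and $Q_m = \frac1m\sum_{j=1}^m \delta_{Y_j}$ be the empirical measures. With $W_2^2(\mu,\nu) = \inf_{\pi} \int \|x-y\|_2^2\,d\pi(x,y)$, the infimum being over all couplings $\pi$ of $\mu$ and $\nu$, put $$e_1 = W_2^2(Q_m, Q) + W_2^2(P_n, P), \qquad e_2 = \int \|x - \mathrm{nn}(x)\|_2^2 \, dP(x), \qquad e_3 = \max_{1\le i\le n} P(V_i),$$ where $\mathrm{nn}(x)$ is a nearest neighbor of $x$ among $X_1,\dots,X_n$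 and $V_i = \{x \in \mathbb{R}^d : \|x - X_i\|_2 \le \|x - X_k\|_2 \text{ for all } k \ne i\}$ is the Voronoi cell of $X_i$. Then $e_1, e_2, e_3$ are random variables (measurable up to null sets) and $$\mathbb{E}[e_1^2] \le C\,\big(m^{-4/d} + n^{-4/d}\big), \qquad \mathbb{E}[e_2] \le C\, n^{-2/d},$$ and, if $n \ge 2$, $$\mathbb{E}[e_3^2] \le C\,\Big(\frac{\log n}{n}\Big)^2.$$ -/

import Mathlib

open MeasureTheory ProbabilityTheory
open scoped ENNReal NNReal

noncomputable section

namespace NNTransport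

/-- A coupling of `P` and `Q`: a measure on the product space with marginals `P` and `Q`. -/
def IsCoupling {d : ℕ} (π : Measure (EuclideanSpace ℝ (Fin d) × EuclideanSpace ℝ (Fin d)))
    (P Q : Measure (EuclideanSpace ℝ (Fin d))) : Prop :=
  π.map Prod.fst = P ∧ π.map Prod.snd = Q

/-- The squared 2-Wasserstein distance, the optimal value of the Kantorovich problem for the
squared Euclidean cost. (When `P` and `Q` have finite second moments, so does every coupling.) -/
def wassersteinSq {d : ℕ} (P Q : Measure (EuclideanSpace ℝ (Fin d))) : ℝ≥0∞ :=
  ⨅ π : {π : Measure (EuclideanSpace ℝ (Fin d) × EuclideanSpace ℝ (Fin d)) // IsCoupling π P Q},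
    ∫⁻ z, ‖z.1 - z.2‖ₑ ^ 2 ∂(π : Measure (EuclideanSpace ℝ (Fin d) × EuclideanSpace ℝ (Fin d)))

/-- The empirical measure of the points `x 0, …, x (n - 1)`. -/
def empiricalMeasure {d n : ℕ} (x : Fin n → EuclideanSpace ℝ (Fin d)) :
    Measure (EuclideanSpace ℝ (Fin d)) :=
  (n : ℝ≥0∞)⁻¹ • ∑ i, Measure.dirac (x i)

/-- The Voronoi cell of the `j`-th point of `x` (closed: ties belong to all the cells involved). -/
def voronoiCell {d n : ℕ} (x : Fin n → EuclideanSpace ℝ (Fin d)) (j : Fin n) :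
    Set (EuclideanSpace ℝ (Fin d)) :=
  {z | ∀ i, i ≠ j → ‖z - x j‖ ≤ ‖z - x i‖}

/-- A nearest neighbour of `z` among the points of `x` (ties are broken arbitrarily). -/
def nearestNeighbor {d n : ℕ} [NeZero n] (x : Fin n → EuclideanSpace ℝ (Fin d))
    (z : EuclideanSpace ℝ (Fin d)) : EuclideanSpace ℝ (Fin d) :=
  x (Finite.exists_min (fun i => ‖z - x i‖)).choose

theorem nearestNeighbor_mem {d n : ℕ} [NeZero n] (x : Fin n → EuclideanSpace ℝ (Fin d))
    (z : EuclideanSpace ℝ (Fin d)) : nearestNeighbor x z ∈ Set.range x :=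
  Set.mem_range_self _

theorem norm_sub_nearestNeighbor_le {d n : ℕ} [NeZero n]
    (x : Fin n → EuclideanSpace ℝ (Fin d)) (z : EuclideanSpace ℝ (Fin d)) (i : Fin n) :
    ‖z - nearestNeighbor x z‖ ≤ ‖z - x i‖ :=
  (Finite.exists_min (fun i => ‖z - x i‖)).choose_spec i

/-- `W₂²(Q_m, Q) + W₂²(P_n, P)` for the empirical measures `P_n` of `x` and `Q_m` of `y`. -/
def e₁ {d n m : ℕ} (P Q : Measure (EuclideanSpace ℝ (Fin d)))
    (x : Fin n → EuclideanSpace ℝ (Fin d)) (y : Fin m → EuclideanSpace ℝ (Fin d)) : ℝ≥0∞ :=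
  wassersteinSq (empiricalMeasure y) Q + wassersteinSq (empiricalMeasure x) P

/-- The mean squared distance of a fresh `P`-distributed point to its nearest neighbour in the
sample `x`. -/
def e₂ {d n : ℕ} [NeZero n] (P : Measure (EuclideanSpace ℝ (Fin d)))
    (x : Fin n → EuclideanSpace ℝ (Fin d)) : ℝ≥0∞ :=
  ∫⁻ z, ‖z - nearestNeighbor x z‖ₑ ^ 2 ∂P

/-- The largest `P`-mass of a Voronoi cell of the sample `x`. -/
def e₃ {d n : ℕ} (P : Measure (EuclideanSpace ℝ (Fin d)))
    (x : Fin n → EuclideanSpace ℝ (Fin d)) : ℝ≥0∞ :=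
  ⨆ i, P (voronoiCell x i)

end NNTransport

end

noncomputable section

namespace NNTransport

/-! ### Partial couplings inside the fibres of a countable labelling. -/

section PartialCoupling

variable {α ι : Type*} [MeasurableSpace α] [MeasurableSpace ι]
  [MeasurableSingletonClass ι] {c : α → ι}

/-! The bound on `e₁` is a multiscale transport estimate. Space is cut into dyadic shells of radius
about `2 ^ k`, and at level `l` each shell meets at most `2 ^ ((l + 1) * d)` cubes of side `2 ^ (k -
l)`. Starting from the finest level `L`, as much mass as possible is coupled inside each cell
(`exists_partial_coupling`), and the leftovers are passed to the next coarser level. Mass removed at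
a fine level is balanced in every coarser cell, so the leftover at level `l` is governed by the
discrepancies of the original measures, which gives `exists_isCoupling_le_cells`. For an empirical
measure the discrepancy of a cell has `L²` norm at most `√(P(cell) / n)`. Minkowski's inequality,
then Cauchy–Schwarz over the cubes of a shell, leaves `∑ 4 ^ k * √P(shell k)`, which converges
because the moment bound gives `P(shell k) ≲ 2 ^ (-r k)` with `r > 4`. The level sum has terms of
order `4 ^ (-l) * 2 ^ (d l / 2) * n ^ (-1/2)`; since `d > 4` its last term dominates, and `2 ^ (d L)
≈ n` turns it into `n ^ (-2/d)`. For `e₂`, every coupling of `P_n` and `P` sends a point to some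
sample point, hence at least as far as its nearest neighbour; so `e₂ ≤ W₂²(P_n, P)`, and
Cauchy–Schwarz in `ω` applies. For `e₃`, finitely many narrow cones with apex `X_i` cover everything
but `X_i`, which has no mass. A sample point `y` in a cone keeps `V_i` from containing points of
that cone as far from `X_i` as `y` is. Hence the part of `V_i` in a cone has mass above `α` only if
all other sample points miss a set of mass at least `α`, which has probability at most `(1 - α) ^ (n
- 1)`. A union bound with `α = 6 log n / n` concludes. Measurability of `e₁` comes from writing
`W₂²(P_n, P)` as an infimum of continuous functions of the sample
(`wassersteinSq_empiricalMeasure`). -/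

theorem sum_smul_restrict_fiber (hc : Measurable c) (μ : Measure α) (t : ι → ℝ≥0∞) (j : ι) :
    Measure.sum (fun i => t i • μ.restrict (c ⁻¹' {i})) (c ⁻¹' {j}) = t j * μ (c ⁻¹' {j}) := by
  have hm : ∀ i, MeasurableSet (c ⁻¹' {i}) := fun i => hc (measurableSet_singleton i)
  rw [Measure.sum_apply _ (hm j), tsum_eq_single j]
  · simp [Measure.restrict_apply (hm j)]
  · intro i hij
    rw [Measure.smul_apply, Measure.restrict_apply (hm j), ← Set.preimage_inter]
    have : ({j} ∩ {i} : Set ι) = ∅ := by simpa using hij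
    simp [this]

variable [Countable ι]

theorem sum_restrict_fiber (hc : Measurable c) (μ : Measure α) :
    Measure.sum (fun i => μ.restrict (c ⁻¹' {i})) = μ := by
  rw [← Measure.restrict_iUnion]
  · rw [← Set.preimage_iUnion, Set.iUnion_of_singleton, Set.preimage_univ, Measure.restrict_univ]
  · intro i j hij
    exact Disjoint.preimage c (by simpa using hij)
  · exact fun i => hc (measurableSet_singleton i)

theorem sum_smul_restrict_add (hc : Measurable c) (μ : Measure α) {t : ι → ℝ≥0∞}
    (ht : ∀ i, t i ≤ 1) :
    Measure.sum (fun i => t i • μ.restrict (c ⁻¹' {i})) +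
      Measure.sum (fun i => (1 - t i) • μ.restrict (c ⁻¹' {i})) = μ := by
  rw [Measure.sum_add_sum]
  conv_rhs => rw [← sum_restrict_fiber hc μ]
  congr 1
  ext1 i
  rw [← add_smul, add_tsub_cancel_of_le (ht i), one_smul]

theorem one_sub_div_max_mul {a b : ℝ≥0∞} (ha : a ≠ ∞) (hb : b ≠ ∞) :
    (1 - (max a b)⁻¹ * b) * a = a - b := by
  rcases le_total a b with h | h
  · rw [max_eq_right h, tsub_eq_zero_of_le h]
    rcases eq_or_ne b 0 with rfl | h0
    · simp [nonpos_iff_eq_zero.1 h]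
    · rw [ENNReal.inv_mul_cancel h0 hb]; simp
  · rw [max_eq_left h]
    rcases eq_or_ne a 0 with rfl | h0
    · simp
    · rw [ENNReal.sub_mul (fun _ _ => ha), one_mul, mul_right_comm, ENNReal.inv_mul_cancel h0 ha,
        one_mul]

theorem inv_max_mul_le_one (a b : ℝ≥0∞) : (max a b)⁻¹ * b ≤ 1 :=
  (mul_le_mul_right (le_max_right a b) _).trans (ENNReal.inv_mul_le_one _)

/-- Two finite measures can be coupled partially, inside the fibres of a countable labelling, so
that the masses left over in each fibre are the differences of the masses of the fibre. -/
theorem exists_partial_coupling (hc : Measurable c) (μ ν : Measure α) [IsFiniteMeasure μ]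
    [IsFiniteMeasure ν] :
    ∃ (π : Measure (α × α)) (μ' ν' : Measure α),
      π.map Prod.fst + μ' = μ ∧ π.map Prod.snd + ν' = ν ∧ (∀ᵐ z ∂π, c z.1 = c z.2) ∧
      (∀ i, μ' (c ⁻¹' {i}) = μ (c ⁻¹' {i}) - ν (c ⁻¹' {i})) ∧
      (∀ i, ν' (c ⁻¹' {i}) = ν (c ⁻¹' {i}) - μ (c ⁻¹' {i})) := by
  have hm : ∀ i, MeasurableSet (c ⁻¹' {i}) := fun i => hc (measurableSet_singleton i)
  -- In each fibre the product of the two restrictions is divided by the larger mass, so the coupled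
  -- mass is the smaller of the two. If both masses vanish the factor is `∞`, but it multiplies the
  -- zero measure.
  refine ⟨Measure.sum fun i => (max (μ (c ⁻¹' {i})) (ν (c ⁻¹' {i})))⁻¹ •
      (μ.restrict (c ⁻¹' {i})).prod (ν.restrict (c ⁻¹' {i})),
    Measure.sum fun i => (1 - (max (μ (c ⁻¹' {i})) (ν (c ⁻¹' {i})))⁻¹ * ν (c ⁻¹' {i})) •
      μ.restrict (c ⁻¹' {i}),
    Measure.sum fun i => (1 - (max (ν (c ⁻¹' {i})) (μ (c ⁻¹' {i})))⁻¹ * μ (c ⁻¹' {i})) •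
      ν.restrict (c ⁻¹' {i}), ?_, ?_, ?_, ?_, ?_⟩
  · rw [Measure.map_sum measurable_fst.aemeasurable]
    convert sum_smul_restrict_add hc μ (t := fun i =>
      (max (μ (c ⁻¹' {i})) (ν (c ⁻¹' {i})))⁻¹ * ν (c ⁻¹' {i})) (fun i => inv_max_mul_le_one _ _)
      using 4 with i
    rw [Measure.map_smul, Measure.map_fst_prod, smul_smul, Measure.restrict_apply_univ]
  · rw [Measure.map_sum measurable_snd.aemeasurable]
    convert sum_smul_restrict_add hc ν (t := fun i =>
      (max (ν (c ⁻¹' {i})) (μ (c ⁻¹' {i})))⁻¹ * μ (c ⁻¹' {i})) (fun i => inv_max_mul_le_one _ _)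
      using 4 with i
    rw [Measure.map_smul, Measure.map_snd_prod, smul_smul, Measure.restrict_apply_univ, max_comm]
  · rw [Measure.ae_sum_iff]
    intro i
    refine Measure.ae_smul_measure ?_ _
    rw [Measure.prod_restrict]
    filter_upwards [ae_restrict_mem ((hm i).prod (hm i))] with z hz
    exact hz.1.trans hz.2.symm
  · intro i
    rw [sum_smul_restrict_fiber hc, one_sub_div_max_mul (measure_ne_top _ _) (measure_ne_top _ _)]
  · intro i
    rw [sum_smul_restrict_fiber hc, one_sub_div_max_mul (measure_ne_top _ _) (measure_ne_top _ _)]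

theorem lintegral_comp_countable (hc : Measurable c) (μ : Measure α) (g : ι → ℝ≥0∞) :
    ∫⁻ x, g (c x) ∂μ = ∑' i, g i * μ (c ⁻¹' {i}) := by
  conv_lhs => rw [← sum_restrict_fiber hc μ]
  rw [lintegral_sum_measure]
  congr 1
  ext1 i
  rw [setLIntegral_congr_fun (g := fun _ => g i) (hc (measurableSet_singleton i))
    (fun x hx => by simp only [Set.mem_preimage, Set.mem_singleton_iff] at hx; simp [hx]),
    setLIntegral_const]

end PartialCoupling

/-! ### Elementary couplings and upper bounds for the transport cost. -/

section Wasserstein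

variable {d : ℕ}

theorem enorm_sub_sq_le (x y : EuclideanSpace ℝ (Fin d)) :
    ‖x - y‖ₑ ^ 2 ≤ 2 * (‖x‖ₑ ^ 2 + ‖y‖ₑ ^ 2) := by
  have h : ‖x - y‖₊ ^ 2 ≤ 2 * (‖x‖₊ ^ 2 + ‖y‖₊ ^ 2) := by
    rw [← NNReal.coe_le_coe]
    push_cast
    have := norm_sub_le x y
    nlinarith [sq_nonneg (‖x‖ - ‖y‖), norm_nonneg (x - y), norm_nonneg x, norm_nonneg y]
  simp only [enorm_eq_nnnorm]
  exact_mod_cast h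

/-- The normalised product measure suffices. This crude bound moves whatever is still unmatched at
the coarsest level. -/
theorem exists_isCoupling_le_moments {μ ν : Measure (EuclideanSpace ℝ (Fin d))} [IsFiniteMeasure μ]
    [IsFiniteMeasure ν] (h : μ Set.univ = ν Set.univ) :
    ∃ π, IsCoupling π μ ν ∧ ∫⁻ z, ‖z.1 - z.2‖ₑ ^ 2 ∂π ≤
      2 * (∫⁻ x, ‖x‖ₑ ^ 2 ∂μ + ∫⁻ y, ‖y‖ₑ ^ 2 ∂ν) := by
  have hc : IsCoupling ((μ Set.univ)⁻¹ • μ.prod ν) μ ν := by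
    rcases eq_or_ne (μ Set.univ) 0 with h0 | h0
    · have hν : ν = 0 := by rwa [h, Measure.measure_univ_eq_zero] at h0
      have hμ : μ = 0 := by rwa [Measure.measure_univ_eq_zero] at h0
      subst hν hμ
      simp [IsCoupling]
    · constructor
      · rw [Measure.map_smul, Measure.map_fst_prod, smul_smul, ← h,
          ENNReal.inv_mul_cancel h0 (measure_ne_top _ _), one_smul]
      · rw [Measure.map_smul, Measure.map_snd_prod, smul_smul,
          ENNReal.inv_mul_cancel h0 (measure_ne_top _ _), one_smul]
  refine ⟨_, hc, ?_⟩
  calc _ ≤ ∫⁻ z, 2 * (‖z.1‖ₑ ^ 2 + ‖z.2‖ₑ ^ 2) ∂((μ Set.univ)⁻¹ • μ.prod ν) :=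
        lintegral_mono fun z => enorm_sub_sq_le _ _
    _ = _ := by
        rw [lintegral_const_mul _ (by fun_prop), lintegral_add_left (by fun_prop)]
        conv_rhs => rw [← hc.1]; enter [2, 2, 1]; rw [← hc.2]
        rw [lintegral_map (by fun_prop) (by fun_prop), lintegral_map (by fun_prop) (by fun_prop)]

theorem IsCoupling.of_add {π π' : Measure (EuclideanSpace ℝ (Fin d) × EuclideanSpace ℝ (Fin d))}
    {μ ν μ' ν' : Measure (EuclideanSpace ℝ (Fin d))} (hμ : π.map Prod.fst + μ' = μ)
    (hν : π.map Prod.snd + ν' = ν) (h : IsCoupling π' μ' ν') : IsCoupling (π + π') μ ν := by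
  constructor
  · rw [Measure.map_add _ _ measurable_fst, h.1, hμ]
  · rw [Measure.map_add _ _ measurable_snd, h.2, hν]

theorem wassersteinSq_le {π : Measure (EuclideanSpace ℝ (Fin d) × EuclideanSpace ℝ (Fin d))}
    {μ ν : Measure (EuclideanSpace ℝ (Fin d))} (h : IsCoupling π μ ν) :
    wassersteinSq μ ν ≤ ∫⁻ z, ‖z.1 - z.2‖ₑ ^ 2 ∂π :=
  iInf_le (fun π : {π // IsCoupling π μ ν} => ∫⁻ z, ‖z.1 - z.2‖ₑ ^ 2 ∂π.1) ⟨π, h⟩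

end Wasserstein

/-! ### Dyadic shells and cubes, and the multiscale transport bound. -/

section Cells

variable {d : ℕ}

/-- The index of the dyadic shell containing `x`: the least `k` with `‖x‖ < 2 ^ k`. -/
def shell (x : EuclideanSpace ℝ (Fin d)) : ℕ := Nat.size ⌊‖x‖⌋₊

/-- The label of the cell of `x` at level `l`: shells are cut into cubes of side `2 ^ (k - l)`,
where `k` is the index of the shell. -/
def cellLabel (l : ℕ) (x : EuclideanSpace ℝ (Fin d)) : ℕ × (Fin d → ℤ) :=
  (shell x, fun i => ⌊2 ^ l * x i / 2 ^ shell x⌋)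

/-- The absolute value of the difference of the masses of a set. -/
def discrepancy (μ ν : Measure (EuclideanSpace ℝ (Fin d))) (s : Set (EuclideanSpace ℝ (Fin d))) :
    ℝ≥0∞ := (μ s - ν s) + (ν s - μ s)

theorem measurable_shell : Measurable (shell (d := d)) :=
  (Measurable.of_discrete (f := Nat.size)).comp (Nat.measurable_floor.comp measurable_norm)

theorem measurable_cellLabel (l : ℕ) : Measurable (cellLabel (d := d) l) := by
  refine measurable_shell.prodMk (measurable_pi_lambda _ fun i => Int.measurable_floor.comp ?_)
  have h : Measurable fun x : EuclideanSpace ℝ (Fin d) => (2 : ℝ) ^ shell x :=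
    (Measurable.of_discrete (f := fun k : ℕ => (2 : ℝ) ^ k)).comp measurable_shell
  have h' : Measurable fun x : EuclideanSpace ℝ (Fin d) => x i := by fun_prop
  exact (h'.const_mul _).div h

theorem norm_lt_two_pow_shell (x : EuclideanSpace ℝ (Fin d)) : ‖x‖ < 2 ^ shell x := by
  have h : ⌊‖x‖⌋₊ < 2 ^ shell x := Nat.size_le.1 le_rfl
  rw [Nat.floor_lt (norm_nonneg x)] at h
  exact_mod_cast h

theorem two_pow_le_norm {x : EuclideanSpace ℝ (Fin d)} {k : ℕ} (h : shell x = k + 1) :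
    2 ^ k ≤ ‖x‖ := by
  have h : 2 ^ k ≤ ⌊‖x‖⌋₊ := Nat.lt_size.1 (by rw [← shell, h]; exact Nat.lt_succ_self k)
  rw [Nat.le_floor_iff (norm_nonneg x)] at h
  exact_mod_cast h

theorem enorm_sq_le_shell (x : EuclideanSpace ℝ (Fin d)) : ‖x‖ₑ ^ 2 ≤ 4 ^ shell x := by
  have h : ‖x‖₊ ^ 2 ≤ 4 ^ shell x := by
    rw [← NNReal.coe_le_coe]
    push_cast
    rw [show (4 : ℝ) = 2 ^ 2 by norm_num, ← pow_mul, mul_comm 2, pow_mul]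
    exact pow_le_pow_left₀ (norm_nonneg x) (norm_lt_two_pow_shell x).le 2
  rw [enorm_eq_nnnorm]
  exact_mod_cast h

/-- The partitions are nested: halving inside a floor is integer division by 2 outside it, so the
finer label determines the coarser one. -/
theorem cellLabel_of_succ {l : ℕ} {x y : EuclideanSpace ℝ (Fin d)}
    (h : cellLabel (l + 1) x = cellLabel (l + 1) y) : cellLabel l x = cellLabel l y := by
  simp only [cellLabel, Prod.mk.injEq] at h ⊢
  refine ⟨h.1, funext fun i => ?_⟩
  have key : ∀ z : EuclideanSpace ℝ (Fin d),
      ⌊2 ^ l * z i / 2 ^ shell z⌋ = ⌊2 ^ (l + 1) * z i / 2 ^ shell z⌋ / 2 := by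
    intro z
    have : 2 ^ l * z i / 2 ^ shell z = (2 ^ (l + 1) * z i / 2 ^ shell z) / (2 : ℕ) := by
      push_cast; rw [pow_succ]; ring
    rw [this, Int.floor_div_natCast]; rfl
  rw [key x, key y, congrFun h.2 i]

theorem cellLabel_of_le {l L : ℕ} (hl : l ≤ L) {x y : EuclideanSpace ℝ (Fin d)}
    (h : cellLabel L x = cellLabel L y) : cellLabel l x = cellLabel l y := by
  induction L, hl using Nat.le_induction with
  | base => exact h
  | succ n _ ih => exact ih (cellLabel_of_succ h)

/-- Points with equal labels lie in the same shell and differ by less than the cube side `2 ^ (k -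
l)` in each of the `d` coordinates. -/
theorem enorm_sub_sq_le_of_cellLabel_eq {l : ℕ} {x y : EuclideanSpace ℝ (Fin d)}
    (h : cellLabel l x = cellLabel l y) :
    ‖x - y‖ₑ ^ 2 ≤ d * (4 ^ l)⁻¹ * 4 ^ shell y := by
  simp only [cellLabel, Prod.mk.injEq] at h
  have hr : ‖x - y‖ ^ 2 ≤ d * (4 ^ l)⁻¹ * 4 ^ shell y := by
    rw [EuclideanSpace.norm_sq_eq]
    calc _ ≤ ∑ i : Fin d, ((4 : ℝ) ^ l)⁻¹ * 4 ^ shell y := by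
          refine Finset.sum_le_sum fun i _ => ?_
          have hi := Int.abs_sub_lt_one_of_floor_eq_floor (congrFun h.2 i)
          rw [h.1, ← sub_div, ← mul_sub, abs_div, abs_mul, abs_of_pos (by positivity),
            abs_of_pos (a := (2 : ℝ) ^ shell y) (by positivity), div_lt_one (by positivity)] at hi
          have h2 := pow_le_pow_left₀ (by positivity) hi.le 2
          rw [mul_pow, ← pow_mul, ← pow_mul, mul_comm l, mul_comm (shell y), pow_mul, pow_mul] at h2
          norm_num at h2
          rw [PiLp.sub_apply, Real.norm_eq_abs, sq_abs, inv_mul_eq_div, le_div_iff₀' (by positivity)]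
          exact h2
      _ = _ := by simp; ring
  have hn : ‖x - y‖₊ ^ 2 ≤ d * (4 ^ l)⁻¹ * 4 ^ shell y := by
    rw [← NNReal.coe_le_coe]
    push_cast
    exact hr
  rw [enorm_eq_nnnorm]
  have := ENNReal.coe_le_coe.2 hn
  push_cast [ENNReal.coe_inv (show (4 : ℝ≥0) ^ l ≠ 0 by positivity)] at this
  exact this

theorem lintegral_four_pow_shell (l : ℕ) (μ : Measure (EuclideanSpace ℝ (Fin d))) :
    ∫⁻ x, 4 ^ shell x ∂μ = ∑' i, 4 ^ i.1 * μ (cellLabel l ⁻¹' {i}) :=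
  lintegral_comp_countable (measurable_cellLabel l) μ (fun i => 4 ^ i.1)

/-- Multiscale upper bound for the optimal transport cost. -/
theorem exists_isCoupling_le_cells (hd : 1 ≤ d) (L : ℕ) :
    ∀ (μ ν : Measure (EuclideanSpace ℝ (Fin d))) [IsFiniteMeasure μ] [IsFiniteMeasure ν],
      μ Set.univ = ν Set.univ → ∃ π, IsCoupling π μ ν ∧
        ∫⁻ z, ‖z.1 - z.2‖ₑ ^ 2 ∂π ≤ d * (4 ^ L)⁻¹ * ∫⁻ x, 4 ^ shell x ∂ν +
          ∑ l ∈ Finset.range (L + 1), 4 * d * (4 ^ l)⁻¹ *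
            ∑' i, 4 ^ i.1 * discrepancy μ ν (cellLabel l ⁻¹' {i}) := by
  have partial_le : ∀ (l : ℕ) (π : Measure (EuclideanSpace ℝ (Fin d) × EuclideanSpace ℝ (Fin d)))
      (ν ν' : Measure (EuclideanSpace ℝ (Fin d))),
      (∀ᵐ z ∂π, cellLabel l z.1 = cellLabel l z.2) → π.map Prod.snd + ν' = ν →
      ∫⁻ z, ‖z.1 - z.2‖ₑ ^ 2 ∂π ≤ d * (4 ^ l)⁻¹ * ∫⁻ x, 4 ^ shell x ∂ν := by
    intro l π ν ν' hae hν
    have hm : Measurable fun x : EuclideanSpace ℝ (Fin d) => (4 : ℝ≥0∞) ^ shell x :=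
      (Measurable.of_discrete (f := fun k : ℕ => (4 : ℝ≥0∞) ^ k)).comp measurable_shell
    calc _ ≤ ∫⁻ z, d * (4 ^ l)⁻¹ * 4 ^ shell z.2 ∂π :=
          lintegral_mono_ae (hae.mono fun z hz => enorm_sub_sq_le_of_cellLabel_eq hz)
      _ = d * (4 ^ l)⁻¹ * ∫⁻ x, 4 ^ shell x ∂(π.map Prod.snd) := by
          rw [lintegral_map hm measurable_snd]
          exact lintegral_const_mul _ (hm.comp measurable_snd)
      _ ≤ _ := by
          gcongr
          rw [← hν]
          exact Measure.le_add_right le_rfl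
  have univ_eq : ∀ (π : Measure (EuclideanSpace ℝ (Fin d) × EuclideanSpace ℝ (Fin d)))
      (μ ν μ' ν' : Measure (EuclideanSpace ℝ (Fin d))) [IsFiniteMeasure μ],
      π.map Prod.fst + μ' = μ → π.map Prod.snd + ν' = ν → μ Set.univ = ν Set.univ →
      μ' Set.univ = ν' Set.univ := by
    intro π μ ν μ' ν' _ hμ hν h
    have hfin : π Set.univ ≠ ∞ := by
      refine ne_top_of_le_ne_top (measure_ne_top μ Set.univ) ?_
      rw [← hμ, Measure.add_apply, Measure.map_apply measurable_fst .univ, Set.preimage_univ]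
      exact le_self_add
    rw [← hμ, ← hν, Measure.add_apply, Measure.add_apply, Measure.map_apply measurable_fst .univ,
      Measure.map_apply measurable_snd .univ, Set.preimage_univ, Set.preimage_univ] at h
    exact (ENNReal.add_right_inj hfin).1 h
  induction L with
  | zero =>
    intro μ ν _ _ h
    obtain ⟨π, μ', ν', hμ, hν, hae, hμ', hν'⟩ :=
      exists_partial_coupling (measurable_cellLabel (d := d) 0) μ ν
    have : IsFiniteMeasure μ' := isFiniteMeasure_of_le μ (hμ ▸ Measure.le_add_left le_rfl)
    have : IsFiniteMeasure ν' := isFiniteMeasure_of_le ν (hν ▸ Measure.le_add_left le_rfl)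
    -- Below level 0 there is nothing coarser: the leftovers are coupled arbitrarily, at a cost of
    -- at most twice their second moments. The factor 2 is absorbed in `4 * d`.
    obtain ⟨π', hπ', hcost⟩ := exists_isCoupling_le_moments (univ_eq π μ ν μ' ν' hμ hν h)
    refine ⟨π + π', IsCoupling.of_add hμ hν hπ', ?_⟩
    rw [lintegral_add_measure]
    refine add_le_add (partial_le 0 π ν ν' hae hν) (hcost.trans ?_)
    calc _ ≤ 2 * (∫⁻ x, 4 ^ shell x ∂μ' + ∫⁻ x, 4 ^ shell x ∂ν') := by
          exact mul_le_mul_right (add_le_add (lintegral_mono fun x => enorm_sq_le_shell x)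
            (lintegral_mono fun x => enorm_sq_le_shell x)) _
      _ = 2 * ∑' i, 4 ^ i.1 * discrepancy μ ν (cellLabel 0 ⁻¹' {i}) := by
          rw [lintegral_four_pow_shell 0, lintegral_four_pow_shell 0, ← ENNReal.tsum_add]
          simp only [hμ', hν', discrepancy, mul_add]
      _ ≤ _ := by
          simp only [zero_add, Finset.range_one, Finset.sum_singleton, pow_zero, inv_one, mul_one]
          gcongr
          calc (2 : ℝ≥0∞) ≤ 4 * 1 := by norm_num
            _ ≤ 4 * d := by gcongr; exact_mod_cast hd
  | succ L ih =>
    intro μ ν _ _ h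
    obtain ⟨π, μ', ν', hμ, hν, hae, hμ', hν'⟩ :=
      exists_partial_coupling (measurable_cellLabel (d := d) (L + 1)) μ ν
    have : IsFiniteMeasure μ' := isFiniteMeasure_of_le μ (hμ ▸ Measure.le_add_left le_rfl)
    have : IsFiniteMeasure ν' := isFiniteMeasure_of_le ν (hν ▸ Measure.le_add_left le_rfl)
    obtain ⟨π', hπ', hcost⟩ := ih μ' ν' (univ_eq π μ ν μ' ν' hμ hν h)
    -- The coupled part gives equal mass to both marginals in each cell of level `L + 1`, hence in
    -- each coarser cell, so removing it leaves all coarser discrepancies unchanged.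
    have hdisc : ∀ l ≤ L, ∀ i, discrepancy μ' ν' (cellLabel l ⁻¹' {i}) =
        discrepancy μ ν (cellLabel l ⁻¹' {i}) := by
      intro l hl i
      have hs : MeasurableSet (cellLabel (d := d) l ⁻¹' {i}) :=
        measurable_cellLabel l (measurableSet_singleton i)
      have heq : π (Prod.snd ⁻¹' (cellLabel l ⁻¹' {i})) =
          π (Prod.fst ⁻¹' (cellLabel l ⁻¹' {i})) := by
        refine measure_congr (hae.mono fun z hz => ?_)
        have := cellLabel_of_le (hl.trans (Nat.le_succ L)) hz
        simp only [eq_iff_iff]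
        change cellLabel l z.2 = i ↔ cellLabel l z.1 = i
        rw [this]
      have hfin : π (Prod.fst ⁻¹' (cellLabel l ⁻¹' {i})) ≠ ∞ := by
        refine ne_top_of_le_ne_top (measure_ne_top μ (cellLabel l ⁻¹' {i})) ?_
        rw [← hμ, Measure.add_apply, Measure.map_apply measurable_fst hs]
        exact le_self_add
      rw [← hμ, ← hν]
      simp only [discrepancy, Measure.add_apply, Measure.map_apply measurable_fst hs,
        Measure.map_apply measurable_snd hs, heq]
      rw [ENNReal.add_sub_add_eq_sub_left hfin, ENNReal.add_sub_add_eq_sub_left hfin]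
    refine ⟨π + π', IsCoupling.of_add hμ hν hπ', ?_⟩
    rw [lintegral_add_measure]
    refine add_le_add (partial_le (L + 1) π ν ν' hae hν) (hcost.trans ?_)
    rw [Finset.sum_range_succ _ (L + 1), add_comm]
    refine add_le_add (Finset.sum_le_sum fun l hl => ?_) ?_
    · simp only [hdisc l (Nat.lt_succ_iff.1 (Finset.mem_range.1 hl))]
      exact le_rfl
    -- The leading term of the induction hypothesis becomes the new summand at level `L + 1`: `d *
    -- (4 ^ L)⁻¹ = 4 * d * (4 ^ (L + 1))⁻¹`, and the mass of `ν'` in a cell is at most the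
    -- discrepancy there. This is the source of the factor 4.
    · rw [lintegral_four_pow_shell (L + 1)]
      refine mul_le_mul' (le_of_eq ?_) (ENNReal.tsum_le_tsum fun i => ?_)
      · rw [pow_succ, ENNReal.mul_inv (by simp) (by simp), mul_comm 4 (d : ℝ≥0∞), mul_assoc,
          mul_comm _ (4⁻¹ : ℝ≥0∞), ← mul_assoc 4, ENNReal.mul_inv_cancel (by simp) (by simp), one_mul]
      · rw [hν', discrepancy]
        gcongr
        exact le_add_self

end Cells

/-- Minkowski's inequality in `L²` for nonnegative series: the square is expanded as a double sum
and Cauchy–Schwarz is applied to each cross term. -/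
theorem lintegral_tsum_mul_sq_le {Ω ι : Type*} [MeasurableSpace Ω] {μ : Measure Ω} [Countable ι]
    {f : ι → Ω → ℝ≥0∞} (hf : ∀ i, AEMeasurable (f i) μ) {a s : ι → ℝ≥0∞}
    (hs : ∀ i, ∫⁻ ω, f i ω ^ 2 ∂μ ≤ s i ^ 2) :
    ∫⁻ ω, (∑' i, a i * f i ω) ^ 2 ∂μ ≤ (∑' i, a i * s i) ^ 2 := by
  have hsq : ∀ u : ι → ℝ≥0∞, (∑' i, u i) ^ 2 = ∑' i, ∑' j, u i * u j := by
    intro u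
    simp_rw [ENNReal.tsum_mul_left, ENNReal.tsum_mul_right, sq]
  have hroot : ∀ i, (∫⁻ ω, f i ω ^ (2 : ℝ) ∂μ) ^ (1 / (2 : ℝ)) ≤ s i := by
    intro i
    rw [one_div, ENNReal.rpow_inv_le_iff two_pos]
    simpa using hs i
  have hmul : ∀ i j, ∫⁻ ω, f i ω * f j ω ∂μ ≤ s i * s j := fun i j =>
    (ENNReal.lintegral_mul_le_Lp_mul_Lq μ Real.HolderConjugate.two_two (hf i) (hf j)).trans
      (mul_le_mul' (hroot i) (hroot j))
  simp_rw [hsq]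
  have hm : ∀ i j, AEMeasurable (fun ω => a i * f i ω * (a j * f j ω)) μ := fun i j =>
    ((hf i).const_mul _).mul ((hf j).const_mul _)
  rw [lintegral_tsum fun i => AEMeasurable.tsum fun j => hm i j]
  refine ENNReal.tsum_le_tsum fun i => ?_
  rw [lintegral_tsum fun j => hm i j]
  refine ENNReal.tsum_le_tsum fun j => ?_
  calc _ = ∫⁻ ω, (a i * a j) * (f i ω * f j ω) ∂μ := by congr 1; ext ω; ring
    _ = (a i * a j) * ∫⁻ ω, f i ω * f j ω ∂μ := lintegral_const_mul'' _ ((hf i).mul (hf j))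
    _ ≤ (a i * a j) * (s i * s j) := by gcongr; exact hmul i j
    _ = _ := by ring

/-! ### Mean square discrepancy of an empirical measure on a fixed set. -/

section Empirical

variable {d n : ℕ}

theorem discrepancy_eq_enorm (μ ν : Measure (EuclideanSpace ℝ (Fin d))) [IsFiniteMeasure μ]
    [IsFiniteMeasure ν] (s : Set (EuclideanSpace ℝ (Fin d))) :
    discrepancy μ ν s = ‖μ.real s - ν.real s‖ₑ := by
  rw [discrepancy, ← ofReal_measureReal, ← ofReal_measureReal,
    ← ENNReal.ofReal_sub _ measureReal_nonneg, ← ENNReal.ofReal_sub _ measureReal_nonneg,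
    Real.enorm_eq_ofReal_abs]
  rcases le_total (μ.real s) (ν.real s) with h | h
  · rw [ENNReal.ofReal_of_nonpos (sub_nonpos.2 h), zero_add, abs_of_nonpos (sub_nonpos.2 h),
      neg_sub]
  · rw [ENNReal.ofReal_of_nonpos (sub_nonpos.2 h), add_zero, abs_of_nonneg (sub_nonneg.2 h)]

instance [NeZero n] (x : Fin n → EuclideanSpace ℝ (Fin d)) :
    IsProbabilityMeasure (empiricalMeasure x) := by
  constructor
  simp only [empiricalMeasure, Measure.smul_apply, Measure.finsetSum_apply, measure_univ]
  simp [ENNReal.inv_mul_cancel (Nat.cast_ne_zero.2 (NeZero.ne n)) (ENNReal.natCast_ne_top n)]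

theorem empiricalMeasure_real_apply (x : Fin n → EuclideanSpace ℝ (Fin d))
    {s : Set (EuclideanSpace ℝ (Fin d))} (hs : MeasurableSet s) :
    (empiricalMeasure x).real s = (n : ℝ)⁻¹ * ∑ i, s.indicator (fun _ => (1 : ℝ)) (x i) := by
  rw [measureReal_def, empiricalMeasure, Measure.smul_apply, Measure.finsetSum_apply, smul_eq_mul,
    ENNReal.toReal_mul, ENNReal.toReal_sum]
  · congr 1
    · simp
    · refine Finset.sum_congr rfl fun i _ => ?_
      rw [Measure.dirac_apply' _ hs]
      by_cases h : x i ∈ s <;> simp [h]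
  · intro i _
    exact measure_ne_top _ _

variable {Ω : Type*} [MeasurableSpace Ω] {μ : Measure Ω}
  {P : Measure (EuclideanSpace ℝ (Fin d))} [IsProbabilityMeasure P]
  {X : Fin n → Ω → EuclideanSpace ℝ (Fin d)}

theorem aemeasurable_discrepancy [NeZero n] (hX : ∀ i, HasLaw (X i) P μ)
    {s : Set (EuclideanSpace ℝ (Fin d))} (hs : MeasurableSet s) :
    AEMeasurable (fun ω => discrepancy (empiricalMeasure fun i => X i ω) P s) μ := by
  simp_rw [discrepancy_eq_enorm, empiricalMeasure_real_apply _ hs]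
  refine AEMeasurable.enorm (AEMeasurable.sub_const (AEMeasurable.const_mul ?_ _) _)
  refine Finset.aemeasurable_fun_sum _ fun i _ => ?_
  exact (measurable_const.indicator hs).comp_aemeasurable (hX i).aemeasurable

variable [IsProbabilityMeasure μ]

/-- The left side is the variance of an average of `n` independent indicators with mean `P s`, each
of variance at most `P s`. -/
theorem lintegral_discrepancy_sq_le [NeZero n] (hind : iIndepFun X μ)
    (hX : ∀ i, HasLaw (X i) P μ) {s : Set (EuclideanSpace ℝ (Fin d))} (hs : MeasurableSet s) :
    ∫⁻ ω, discrepancy (empiricalMeasure fun i => X i ω) P s ^ 2 ∂μ ≤ P s / n := by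
  have hn : (n : ℝ) ≠ 0 := Nat.cast_ne_zero.2 (NeZero.ne n)
  set φ : EuclideanSpace ℝ (Fin d) → ℝ := s.indicator fun _ => 1 with hφ
  have hφm : Measurable φ := measurable_const.indicator hs
  set Z : Fin n → Ω → ℝ := fun i => φ ∘ X i with hZ
  have hZm : ∀ i, AEMeasurable (Z i) μ := fun i => hφm.comp_aemeasurable (hX i).aemeasurable
  have hL : ∀ i, MemLp (Z i) 2 μ := fun i =>
    MemLp.of_bound (hZm i).aestronglyMeasurable 1 (ae_of_all _ fun ω => by
      by_cases h : X i ω ∈ s <;> simp [hZ, hφ, h])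
  have hmean : ∀ i, μ[Z i] = P.real s := by
    intro i
    rw [← (hX i).map_eq, hZ]
    change ∫ ω, φ (X i ω) ∂μ = _
    rw [← integral_map (hX i).aemeasurable hφm.aestronglyMeasurable, hφ,
      integral_indicator_const _ hs]
    simp
  have hvar : ∀ i, Var[Z i; μ] ≤ P.real s := by
    intro i
    refine (variance_le_expectation_sq (hZm i).aestronglyMeasurable).trans (le_of_eq ?_)
    rw [← hmean i]
    congr 1
    ext ω
    by_cases h : X i ω ∈ s <;> simp [hZ, hφ, h]
  set A : Ω → ℝ := fun ω => (n : ℝ)⁻¹ * (∑ i, Z i) ω with hA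
  have hAL : MemLp A 2 μ := (memLp_finsetSum' _ fun i _ => hL i).const_mul _
  have hAmean : μ[A] = P.real s := by
    rw [hA, integral_const_mul]
    simp only [Finset.sum_apply]
    rw [integral_finsetSum _ fun i _ => (hL i).integrable one_le_two]
    simp only [hmean, Finset.sum_const, Finset.card_univ, Fintype.card_fin, nsmul_eq_mul]
    field_simp
  have hAvar : Var[A; μ] ≤ P.real s / n := by
    rw [hA, variance_const_mul, IndepFun.variance_sum (fun i _ => hL i)]
    · calc _ ≤ (n : ℝ)⁻¹ ^ 2 * ∑ _i : Fin n, P.real s := by gcongr; exact hvar _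
        _ = _ := by simp; field_simp
    · intro i _ j _ hij
      exact (hind.indepFun hij).comp hφm hφm
  have heq : ∀ ω, discrepancy (empiricalMeasure fun i => X i ω) P s = ‖A ω - μ[A]‖ₑ := by
    intro ω
    rw [discrepancy_eq_enorm, empiricalMeasure_real_apply _ hs, hAmean, hA]
    simp [hZ, hφ]
  simp_rw [heq]
  calc _ = evariance A μ := rfl
    _ = ENNReal.ofReal (Var[A; μ]) := hAL.ofReal_variance_eq.symm
    _ ≤ ENNReal.ofReal (P.real s / n) := ENNReal.ofReal_le_ofReal hAvar
    _ = P s / n := by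
      rw [ENNReal.ofReal_div_of_pos (by positivity), ofReal_measureReal, ENNReal.ofReal_natCast]

end Empirical

/-! ### Sums over cells and the use of the moment bound. -/

section CellSums

variable {d : ℕ}

theorem cellLabel_snd_mem {l : ℕ} (x : EuclideanSpace ℝ (Fin d)) :
    (cellLabel l x).2 ∈ Fintype.piFinset fun _ : Fin d => Finset.Ico (-2 ^ l : ℤ) (2 ^ l) := by
  rw [Fintype.mem_piFinset]
  intro i
  have h : |x i| < 2 ^ shell x :=
    (by simpa using PiLp.norm_apply_le x i : |x i| ≤ ‖x‖).trans_lt (norm_lt_two_pow_shell x)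
  rw [abs_lt] at h
  rw [Finset.mem_Ico, cellLabel, Int.le_floor, Int.floor_lt, le_div_iff₀ (by positivity),
    div_lt_iff₀ (by positivity)]
  push_cast
  constructor
  · rw [neg_mul, ← mul_neg]
    exact mul_le_mul_of_nonneg_left h.1.le (by positivity)
  · exact mul_lt_mul_of_pos_left h.2 (by positivity)

theorem tsum_rpow_half_cell_le (l k : ℕ) (P : Measure (EuclideanSpace ℝ (Fin d))) (t : ℝ≥0∞) :
    ∑' v, (P (cellLabel l ⁻¹' {(k, v)}) * t) ^ (1 / 2 : ℝ) ≤
      ((2 ^ (l + 1)) ^ d * t) ^ (1 / 2 : ℝ) * P (shell ⁻¹' {k}) ^ (1 / 2 : ℝ) := by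
  set T := Fintype.piFinset fun _ : Fin d => Finset.Ico (-2 ^ l : ℤ) (2 ^ l) with hT
  have hcard : T.card = (2 ^ (l + 1)) ^ d := by
    rw [hT, Fintype.card_piFinset_const, Int.card_Ico]
    congr 1
    rw [pow_succ]
    have : (2 ^ l - -2 ^ l : ℤ) = ((2 ^ l * 2 : ℕ) : ℤ) := by push_cast; ring
    rw [this, Int.toNat_natCast]
  -- Only labels in `T` occur in the shell, so Cauchy–Schwarz on this finite sum costs the square
  -- root of its cardinality, `2 ^ ((l + 1) * d)`.
  rw [tsum_eq_sum (s := T)]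
  · rw [← ENNReal.mul_rpow_of_nonneg _ _ (by norm_num), one_div, ENNReal.le_rpow_inv_iff two_pos]
    refine (ENNReal.rpow_sum_le_const_mul_sum_rpow _ _ one_le_two).trans ?_
    simp_rw [← ENNReal.rpow_mul]
    norm_num
    rw [← Finset.sum_mul, hcard, mul_assoc, mul_comm t]
    push_cast
    gcongr
    rw [← measure_biUnion_finset]
    · refine measure_mono (Set.iUnion₂_subset fun v _ x hx => ?_)
      simp only [cellLabel, Set.mem_preimage, Set.mem_singleton_iff, Prod.mk.injEq] at hx ⊢
      exact hx.1
    · intro v _ w _ hvw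
      exact Disjoint.preimage _ (by simpa using hvw)
    · exact fun v _ => measurable_cellLabel l (measurableSet_singleton _)
  · intro v hv
    have : cellLabel l ⁻¹' {(k, v)} = (∅ : Set (EuclideanSpace ℝ (Fin d))) := by
      ext x
      simp only [Set.mem_preimage, Set.mem_singleton_iff, Set.mem_empty_iff_false, iff_false]
      intro h
      exact hv (by have := cellLabel_snd_mem (l := l) x; rwa [h] at this)
    simp [this]

theorem tsum_cells_le (l : ℕ) (P : Measure (EuclideanSpace ℝ (Fin d))) (t : ℝ≥0∞) :
    ∑' i : ℕ × (Fin d → ℤ), 4 ^ i.1 * (P (cellLabel l ⁻¹' {i}) * t) ^ (1 / 2 : ℝ) ≤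
      ((2 ^ (l + 1)) ^ d * t) ^ (1 / 2 : ℝ) *
        ∑' k : ℕ, 4 ^ k * P (shell ⁻¹' {k}) ^ (1 / 2 : ℝ) := by
  rw [ENNReal.tsum_prod', ← ENNReal.tsum_mul_left]
  refine ENNReal.tsum_le_tsum fun k => ?_
  dsimp only
  rw [ENNReal.tsum_mul_left, mul_left_comm]
  gcongr
  exact tsum_rpow_half_cell_le l k P t

/-- Markov's inequality, since shell `k + 1` lies outside the ball of radius `2 ^ k`. The factor `2
^ r` pays for the index shift, and the `1` in `1 + B` covers shell 0. -/
theorem measure_shell_le {P : Measure (EuclideanSpace ℝ (Fin d))} [IsProbabilityMeasure P]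
    {r : ℝ} (hr : 0 < r) {B : ℝ≥0∞} (hP : ∫⁻ x, ‖x‖ₑ ^ r ∂P ≤ B) (k : ℕ) :
    P (shell ⁻¹' {k}) ≤ (2 : ℝ≥0∞) ^ r * (1 + B) * ((2 : ℝ≥0∞) ^ (-r)) ^ k := by
  cases k with
  | zero =>
    rw [pow_zero, mul_one]
    calc _ ≤ (1 : ℝ≥0∞) := prob_le_one
      _ = 1 * 1 := (one_mul 1).symm
      _ ≤ _ := mul_le_mul' (ENNReal.one_le_rpow one_le_two hr) le_self_add
  | succ k =>
    have h1 : ((2 : ℝ≥0∞) ^ r) ^ k * P (shell ⁻¹' {k + 1}) ≤ B := by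
      refine le_trans ?_ ((mul_meas_ge_le_lintegral₀ (by fun_prop)
        (((2 : ℝ≥0∞) ^ r) ^ k)).trans hP)
      gcongr
      intro x hx
      have h2 : (2 : ℝ≥0∞) ^ k ≤ ‖x‖ₑ := by
        have h3 : (2 : ℝ≥0) ^ k ≤ ‖x‖₊ := by
          rw [← NNReal.coe_le_coe]; push_cast; exact two_pow_le_norm hx
        rw [enorm_eq_nnnorm]
        exact_mod_cast h3
      calc ((2 : ℝ≥0∞) ^ r) ^ k = ((2 : ℝ≥0∞) ^ k) ^ r := by
            rw [← ENNReal.rpow_natCast, ← ENNReal.rpow_natCast, ← ENNReal.rpow_mul,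
              ← ENNReal.rpow_mul, mul_comm]
        _ ≤ _ := ENNReal.rpow_le_rpow h2 hr.le
    have h0 : (2 : ℝ≥0∞) ^ r ≠ 0 := by simp
    have ht : (2 : ℝ≥0∞) ^ r ≠ ∞ := ENNReal.rpow_ne_top_of_nonneg hr.le (by simp)
    rw [ENNReal.rpow_neg, pow_succ, mul_right_comm, mul_comm (_ ^ k), ← mul_assoc,
      ENNReal.mul_inv_cancel h0 ht, one_mul, ← ENNReal.inv_pow, mul_comm, ← div_eq_mul_inv,
      ENNReal.le_div_iff_mul_le (by simp) (by simp [ht]), mul_comm]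
    exact h1.trans le_add_self

/-- A bound for `∑ 4 ^ k * P(shell k) ^ (1/2)` over measures with `∫ ‖x‖ ^ r ≤ B`. -/
def shellBound (r : ℝ) (B : ℝ≥0∞) : ℝ≥0∞ :=
  ((2 : ℝ≥0∞) ^ r * (1 + B)) ^ (1 / 2 : ℝ) * (1 - 4 * (2 : ℝ≥0∞) ^ (-(r / 2)))⁻¹

/-- The geometric ratio is `2 ^ (2 - r / 2)`, which is below 1 because `r > 4`. -/
theorem shellBound_ne_top {r : ℝ} (hr : 4 < r) {B : ℝ≥0∞} (hB : B ≠ ∞) : shellBound r B ≠ ∞ := by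
  refine ENNReal.mul_ne_top (ENNReal.rpow_ne_top_of_nonneg (by norm_num) (ENNReal.mul_ne_top
    (ENNReal.rpow_ne_top_of_nonneg (by linarith) (by simp)) (by simp [hB]))) ?_
  rw [ENNReal.inv_ne_top, ne_eq, tsub_eq_zero_iff_le, not_le]
  have h4 : (4 : ℝ≥0∞) = 2 ^ (2 : ℝ) := by norm_num
  rw [h4, ← ENNReal.rpow_add _ _ (by simp) (by simp)]
  exact ENNReal.rpow_lt_one_of_one_lt_of_neg (by simp) (by linarith)

theorem tsum_shell_le {P : Measure (EuclideanSpace ℝ (Fin d))} [IsProbabilityMeasure P]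
    {r : ℝ} (hr : 0 < r) {B : ℝ≥0∞} (hP : ∫⁻ x, ‖x‖ₑ ^ r ∂P ≤ B) :
    ∑' k : ℕ, 4 ^ k * P (shell ⁻¹' {k}) ^ (1 / 2 : ℝ) ≤ shellBound r B := by
  rw [shellBound, ← ENNReal.tsum_geometric, ← ENNReal.tsum_mul_left]
  refine ENNReal.tsum_le_tsum fun k => ?_
  rw [mul_pow, mul_left_comm]
  gcongr
  calc _ ≤ ((2 : ℝ≥0∞) ^ r * (1 + B) * ((2 : ℝ≥0∞) ^ (-r)) ^ k) ^ (1 / 2 : ℝ) := by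
        gcongr; exact measure_shell_le hr hP k
    _ = _ := by
        rw [ENNReal.mul_rpow_of_nonneg _ _ (by norm_num)]
        congr 1
        rw [← ENNReal.rpow_natCast, ← ENNReal.rpow_natCast, ← ENNReal.rpow_mul,
          ← ENNReal.rpow_mul, ← ENNReal.rpow_mul]
        congr 1
        ring

theorem lintegral_four_pow_shell_le {P : Measure (EuclideanSpace ℝ (Fin d))}
    [IsProbabilityMeasure P] {r : ℝ} (hr : 0 < r) {B : ℝ≥0∞} (hP : ∫⁻ x, ‖x‖ₑ ^ r ∂P ≤ B) :
    ∫⁻ x, 4 ^ shell x ∂P ≤ shellBound r B := by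
  rw [lintegral_comp_countable measurable_shell P fun k => 4 ^ k]
  refine le_trans (ENNReal.tsum_le_tsum fun k => ?_) (tsum_shell_le hr hP)
  gcongr
  -- A probability is at most its square root, so the same series bounds this integral.
  conv_lhs => rw [← ENNReal.rpow_one (P _)]
  exact ENNReal.rpow_le_rpow_of_exponent_ge prob_le_one (by norm_num)

end CellSums

/-! ### Choice of the finest level and the resulting rate. -/

section Rates

variable {d n : ℕ}

/-- The finest level `L` is the integer logarithm of `n` in base `2 ^ d`; raising `n ≤ 2 ^ (d * (L +
1))` to the power `2 / d` gives the claim, with factor 4 from rounding. -/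
theorem inv_four_pow_log_le (hd : 0 < d) (hn : 0 < n) :
    ((4 : ℝ) ^ Nat.log (2 ^ d) n)⁻¹ ≤ 4 * (n : ℝ) ^ (-(2 : ℝ) / d) := by
  have hd' : (0 : ℝ) < d := Nat.cast_pos.2 hd
  have hn' : (0 : ℝ) < n := Nat.cast_pos.2 hn
  set L := Nat.log (2 ^ d) n
  have h1 : (n : ℝ) ≤ ((2 : ℝ) ^ d) ^ (L + 1) := by
    exact_mod_cast (Nat.lt_pow_succ_log_self (Nat.one_lt_two_pow hd.ne') n).le
  have h2 : (n : ℝ) ^ ((2 : ℝ) / d) ≤ 4 ^ (L + 1) := by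
    calc _ ≤ (((2 : ℝ) ^ d) ^ (L + 1)) ^ ((2 : ℝ) / d) := by gcongr
      _ = 4 ^ (L + 1) := by
        rw [← pow_mul, ← Real.rpow_natCast, ← Real.rpow_mul (by norm_num),
          show (4 : ℝ) = 2 ^ (2 : ℝ) by norm_num, ← Real.rpow_natCast (2 ^ (2 : ℝ)),
          ← Real.rpow_mul (by norm_num)]
        congr 1
        push_cast
        field_simp
  rw [neg_div, Real.rpow_neg hn'.le, ← div_eq_mul_inv, le_div_iff₀ (by positivity),
    inv_mul_le_iff₀ (by positivity), ← pow_succ]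
  exact h2

theorem sum_levels_le (hd : 4 < d) (hn : 0 < n) :
    ∑ l ∈ Finset.range (Nat.log (2 ^ d) n + 1),
      ((4 : ℝ) ^ l)⁻¹ * ((2 ^ (l + 1)) ^ d * (n : ℝ)⁻¹) ^ (1 / 2 : ℝ) ≤
        16 * (2 ^ d) ^ (1 / 2 : ℝ) * (n : ℝ) ^ (-(2 : ℝ) / d) := by
  set L := Nat.log (2 ^ d) n with hL
  set s : ℝ := (2 ^ d) ^ (1 / 2 : ℝ) with hs
  have hspos : 0 < s := by positivity
  set q : ℝ := s / 4 with hq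
  -- Here `d ≥ 5` enters: `√32 ≥ 16 / 3`. A ratio of at least `4 / 3` is exactly what bounds the
  -- geometric sum by 4 times its last term.
  have hq43 : 4 / 3 ≤ q := by
    have h : (16 / 3 : ℝ) ≤ s := by
      rw [hs, ← Real.sqrt_eq_rpow]
      refine Real.le_sqrt_of_sq_le ?_
      calc (16 / 3 : ℝ) ^ 2 ≤ 2 ^ 5 := by norm_num
        _ ≤ 2 ^ d := pow_le_pow_right₀ (by norm_num) hd
    rw [hq]; linarith
  have hspow : ∀ l : ℕ, s ^ l = ((2 ^ l) ^ d : ℝ) ^ (1 / 2 : ℝ) := by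
    intro l
    rw [hs, ← Real.rpow_natCast, ← Real.rpow_mul (by positivity), mul_comm, Real.rpow_mul
      (by positivity), Real.rpow_natCast, ← pow_mul, ← pow_mul, mul_comm]
  have hgeom : ∑ l ∈ Finset.range (L + 1), q ^ l ≤ 4 * q ^ L := by
    rw [geom_sum_eq (by linarith), div_le_iff₀ (by linarith), pow_succ]
    have : 0 < q ^ L := by positivity
    nlinarith
  -- The left side equals `4 ^ (-L)` times the square root of `2 ^ (d * L) / n`, and this quotient
  -- is at most 1 by the choice of `L`.
  have hqL : q ^ L * ((n : ℝ)⁻¹) ^ (1 / 2 : ℝ) ≤ 4 * (n : ℝ) ^ (-(2 : ℝ) / d) := by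
    refine le_trans ?_ (inv_four_pow_log_le (by omega) hn)
    rw [hq, div_pow, div_eq_mul_inv, mul_right_comm, hspow, ← Real.mul_rpow (by positivity)
      (by positivity)]
    refine mul_le_of_le_one_left (by positivity) (Real.rpow_le_one (by positivity) ?_ (by norm_num))
    rw [← div_eq_mul_inv, div_le_one (by exact_mod_cast hn), ← pow_mul, mul_comm, pow_mul]
    exact_mod_cast Nat.pow_log_le_self _ hn.ne'
  calc _ = ∑ l ∈ Finset.range (L + 1), s * ((n : ℝ)⁻¹) ^ (1 / 2 : ℝ) * q ^ l := by
        refine Finset.sum_congr rfl fun l _ => ?_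
        rw [Real.mul_rpow (by positivity) (by positivity), ← hspow, hq, div_pow, pow_succ]
        field_simp
    _ = s * ((n : ℝ)⁻¹) ^ (1 / 2 : ℝ) * ∑ l ∈ Finset.range (L + 1), q ^ l := by
        rw [Finset.mul_sum]
    _ ≤ s * ((n : ℝ)⁻¹) ^ (1 / 2 : ℝ) * (4 * q ^ L) := by gcongr
    _ = 4 * s * (q ^ L * ((n : ℝ)⁻¹) ^ (1 / 2 : ℝ)) := by ring
    _ ≤ 4 * s * (4 * (n : ℝ) ^ (-(2 : ℝ) / d)) := by gcongr
    _ = _ := by ring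

theorem sum_levels_ennreal_le (hd : 4 < d) (hn : 0 < n) :
    ∑ l ∈ Finset.range (Nat.log (2 ^ d) n + 1),
      ((4 : ℝ≥0∞) ^ l)⁻¹ * ((2 ^ (l + 1)) ^ d * (n : ℝ≥0∞)⁻¹) ^ (1 / 2 : ℝ) ≤
        ENNReal.ofReal (16 * (2 ^ d) ^ (1 / 2 : ℝ) * (n : ℝ) ^ (-(2 : ℝ) / d)) := by
  refine le_trans (le_of_eq ?_) (ENNReal.ofReal_le_ofReal (sum_levels_le hd hn))
  rw [ENNReal.ofReal_sum_of_nonneg fun _ _ => by positivity]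
  refine Finset.sum_congr rfl fun l _ => ?_
  have hn' : (0 : ℝ) < n := Nat.cast_pos.2 hn
  rw [ENNReal.ofReal_mul (by positivity), ENNReal.ofReal_inv_of_pos (by positivity),
    ENNReal.ofReal_pow (by norm_num), ← ENNReal.ofReal_rpow_of_nonneg (by positivity) (by norm_num),
    ENNReal.ofReal_mul (by positivity), ENNReal.ofReal_inv_of_pos hn', ENNReal.ofReal_natCast,
    ENNReal.ofReal_pow (by positivity), ENNReal.ofReal_pow (by norm_num)]
  norm_num

variable {Ω : Type*} [MeasurableSpace Ω] {μ : Measure Ω} [IsProbabilityMeasure μ]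
  {P : Measure (EuclideanSpace ℝ (Fin d))} [IsProbabilityMeasure P]
  {X : Fin n → Ω → EuclideanSpace ℝ (Fin d)}

theorem wassersteinSq_le_cells (hd : 1 ≤ d) (L : ℕ) (μ ν : Measure (EuclideanSpace ℝ (Fin d)))
    [IsProbabilityMeasure μ] [IsProbabilityMeasure ν] :
    wassersteinSq μ ν ≤ d * (4 ^ L)⁻¹ * ∫⁻ x, 4 ^ shell x ∂ν +
      ∑' p : Fin (L + 1) × (ℕ × (Fin d → ℤ)), 4 * d * ((4 ^ p.1.val)⁻¹ * 4 ^ p.2.1) *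
        discrepancy μ ν (cellLabel p.1 ⁻¹' {p.2}) := by
  obtain ⟨π, hπ, h⟩ := exists_isCoupling_le_cells hd L μ ν (by simp)
  refine (wassersteinSq_le hπ).trans (h.trans (le_of_eq ?_))
  congr 1
  rw [ENNReal.tsum_prod', tsum_fintype, Finset.sum_range]
  refine Finset.sum_congr rfl fun l _ => ?_
  rw [← ENNReal.tsum_mul_left]
  congr 1
  ext1 i
  ring

/-- Rate of convergence of the empirical measure, in mean square of the squared distance. -/
theorem lintegral_wassersteinSq_sq_le [NeZero n] (hd : 4 < d) {r : ℝ} (hr : 0 < r) {B : ℝ≥0∞}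
    (hP : ∫⁻ x, ‖x‖ₑ ^ r ∂P ≤ B) (hind : iIndepFun X μ) (hX : ∀ i, HasLaw (X i) P μ) :
    ∫⁻ ω, wassersteinSq (empiricalMeasure fun i => X i ω) P ^ 2 ∂μ ≤
      ENNReal.ofReal (2 * ((4 * d) ^ 2 + (64 * d * (2 ^ d) ^ (1 / 2 : ℝ)) ^ 2) *
        (n : ℝ) ^ (-(4 : ℝ) / d)) * shellBound r B ^ 2 := by
  have hn : 0 < n := Nat.pos_of_ne_zero (NeZero.ne n)
  have hn' : (0 : ℝ) < n := Nat.cast_pos.2 hn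
  set S := shellBound r B with hS
  set L := Nat.log (2 ^ d) n with hL
  set R : ℝ := (n : ℝ) ^ (-(2 : ℝ) / d) with hR
  set A : ℝ≥0∞ := d * (4 ^ L)⁻¹ * ∫⁻ x, 4 ^ shell x ∂P with hA
  have hA_le : A ≤ ENNReal.ofReal (4 * d * R) * S := by
    refine mul_le_mul' ?_ (lintegral_four_pow_shell_le hr hP)
    rw [show (4 * d * R : ℝ) = d * (4 * R) by ring, ENNReal.ofReal_mul (by positivity),
      ENNReal.ofReal_natCast]
    gcongr
    refine le_trans (le_of_eq ?_)
      (ENNReal.ofReal_le_ofReal (inv_four_pow_log_le (d := d) (by omega) hn))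
    rw [ENNReal.ofReal_inv_of_pos (by positivity), ENNReal.ofReal_pow (by norm_num),
      ENNReal.ofReal_ofNat]
  let a : Fin (L + 1) × (ℕ × (Fin d → ℤ)) → ℝ≥0∞ := fun p =>
    4 * d * ((4 ^ p.1.val)⁻¹ * 4 ^ p.2.1)
  let f : Fin (L + 1) × (ℕ × (Fin d → ℤ)) → Ω → ℝ≥0∞ := fun p ω =>
    discrepancy (empiricalMeasure fun i => X i ω) P (cellLabel p.1 ⁻¹' {p.2})
  have hm : ∀ (l : ℕ) (i : ℕ × (Fin d → ℤ)), MeasurableSet (cellLabel (d := d) l ⁻¹' {i}) :=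
    fun l i => measurable_cellLabel l (measurableSet_singleton i)
  have hf : ∀ p, AEMeasurable (f p) μ := fun p => aemeasurable_discrepancy hX (hm _ _)
  -- Minkowski over all levels and cells at once. The constant is `4 * d` from the transport bound
  -- times `16 * (2 ^ d) ^ (1 / 2)` from the level sum.
  have hT : ∫⁻ ω, (∑' p, a p * f p ω) ^ 2 ∂μ ≤
      (ENNReal.ofReal (64 * d * (2 ^ d) ^ (1 / 2 : ℝ) * R) * S) ^ 2 := by
    refine (lintegral_tsum_mul_sq_le (a := a) hf (s := fun p =>
      (P (cellLabel p.1 ⁻¹' {p.2}) * (n : ℝ≥0∞)⁻¹) ^ (1 / 2 : ℝ)) fun p => ?_).trans ?_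
    · rw [← ENNReal.rpow_natCast, ← ENNReal.rpow_mul]
      norm_num
      exact lintegral_discrepancy_sq_le hind hX (hm _ _)
    · refine pow_le_pow_left' ?_ 2
      rw [ENNReal.tsum_prod', tsum_fintype]
      calc _ ≤ ∑ l : Fin (L + 1), 4 * d * S * (((4 : ℝ≥0∞) ^ l.val)⁻¹ *
            ((2 ^ (l.val + 1)) ^ d * (n : ℝ≥0∞)⁻¹) ^ (1 / 2 : ℝ)) := by
            refine Finset.sum_le_sum fun l _ => ?_
            calc _ = 4 * d * (4 ^ l.val)⁻¹ * ∑' i : ℕ × (Fin d → ℤ),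
                  4 ^ i.1 * (P (cellLabel l ⁻¹' {i}) * (n : ℝ≥0∞)⁻¹) ^ (1 / 2 : ℝ) := by
                  rw [← ENNReal.tsum_mul_left]
                  congr 1
                  ext1 i
                  simp only [a]
                  ring
              _ ≤ 4 * d * (4 ^ l.val)⁻¹ *
                  (((2 ^ (l.val + 1)) ^ d * (n : ℝ≥0∞)⁻¹) ^ (1 / 2 : ℝ) * S) := by
                  gcongr
                  exact (tsum_cells_le _ _ _).trans (by gcongr; exact tsum_shell_le hr hP)
              _ = _ := by ring
        _ = 4 * d * S * ∑ l ∈ Finset.range (L + 1), ((4 : ℝ≥0∞) ^ l)⁻¹ *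
            ((2 ^ (l + 1)) ^ d * (n : ℝ≥0∞)⁻¹) ^ (1 / 2 : ℝ) := by
            rw [← Finset.mul_sum, Finset.sum_range]
        _ ≤ 4 * d * S * ENNReal.ofReal (16 * (2 ^ d) ^ (1 / 2 : ℝ) * R) := by
            gcongr; exact sum_levels_ennreal_le hd hn
        _ = _ := by
            rw [show (64 * d * (2 ^ d) ^ (1 / 2 : ℝ) * R : ℝ) =
              4 * (d * (16 * (2 ^ d) ^ (1 / 2 : ℝ) * R)) by ring,
              ENNReal.ofReal_mul (p := 4) (by norm_num),
              ENNReal.ofReal_mul (p := (d : ℝ)) (Nat.cast_nonneg d), ENNReal.ofReal_natCast,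
              ENNReal.ofReal_ofNat]
            ring
  have hsq : ∀ u v : ℝ≥0∞, (u + v) ^ 2 ≤ 2 * (u ^ 2 + v ^ 2) := by
    intro u v
    have := ENNReal.rpow_add_le_mul_rpow_add_rpow u v one_le_two
    norm_num at this
    exact this
  calc _ ≤ ∫⁻ ω, 2 * (A ^ 2 + (∑' p, a p * f p ω) ^ 2) ∂μ := by
        refine lintegral_mono fun ω => le_trans ?_ (hsq _ _)
        exact pow_le_pow_left' (wassersteinSq_le_cells (by omega) L _ P) 2
    _ = 2 * (A ^ 2 + ∫⁻ ω, (∑' p, a p * f p ω) ^ 2 ∂μ) := by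
        rw [lintegral_const_mul' _ _ (by norm_num), lintegral_add_left measurable_const]
        simp
    _ ≤ 2 * ((ENNReal.ofReal (4 * d * R) * S) ^ 2 +
          (ENNReal.ofReal (64 * d * (2 ^ d) ^ (1 / 2 : ℝ) * R) * S) ^ 2) := by gcongr
    _ = _ := by
        have hR2 : R ^ 2 = (n : ℝ) ^ (-(4 : ℝ) / d) := by
          rw [hR, ← Real.rpow_natCast, ← Real.rpow_mul hn'.le]
          congr 1
          push_cast
          ring
        rw [← hR2, mul_pow, mul_pow, ← ENNReal.ofReal_pow (by positivity),
          ← ENNReal.ofReal_pow (by positivity), ← add_mul, ← mul_assoc,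
          ← ENNReal.ofReal_add (by positivity) (by positivity)]
        congr 1
        rw [show (2 : ℝ≥0∞) = ENNReal.ofReal 2 by norm_num, ← ENNReal.ofReal_mul (by norm_num)]
        congr 1
        ring

end Rates

/-! ### Transport from an empirical measure: measurability and nearest neighbours. -/

section EmpiricalTransport

variable {d n : ℕ}

theorem empiricalMeasure_singleton (x : Fin n → EuclideanSpace ℝ (Fin d)) (i : Fin n) :
    empiricalMeasure x {x i} = (n : ℝ≥0∞)⁻¹ * (Finset.univ.filter fun j => x j = x i).card := by
  simp [empiricalMeasure, Set.indicator_apply, Finset.sum_boole]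

theorem ae_mem_range_of_map_fst {x : Fin n → EuclideanSpace ℝ (Fin d)}
    {π : Measure (EuclideanSpace ℝ (Fin d) × EuclideanSpace ℝ (Fin d))}
    (h : π.map Prod.fst = empiricalMeasure x) : ∀ᵐ z ∂π, z.1 ∈ Set.range x := by
  have hm : MeasurableSet (Set.range x) := (Set.finite_range x).measurableSet
  have : ∀ᵐ y ∂(π.map Prod.fst), y ∈ Set.range x := by
    rw [h, empiricalMeasure]
    refine Measure.ae_smul_measure ?_ _
    rw [← Measure.sum_fintype, Measure.ae_sum_iff]
    intro i
    exact (ae_dirac_iff hm).2 (Set.mem_range_self i)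
  exact ae_of_ae_map measurable_fst.aemeasurable this

/-- Sample points may coincide, and then the same fibre of `π` is counted once for each index;
dividing by the multiplicity corrects this. -/
theorem sum_inv_card_smul_restrict {x : Fin n → EuclideanSpace ℝ (Fin d)}
    {π : Measure (EuclideanSpace ℝ (Fin d) × EuclideanSpace ℝ (Fin d))}
    (h : π.map Prod.fst = empiricalMeasure x) :
    ∑ i, ((Finset.univ.filter fun j => x j = x i).card : ℝ≥0∞)⁻¹ •
      π.restrict (Prod.fst ⁻¹' {x i}) = π := by
  have hA : ∀ i, MeasurableSet (Prod.fst ⁻¹' {x i} :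
      Set (EuclideanSpace ℝ (Fin d) × EuclideanSpace ℝ (Fin d))) := fun i =>
    measurable_fst (measurableSet_singleton _)
  ext s hs
  rw [Measure.finsetSum_apply]
  simp only [Measure.smul_apply, smul_eq_mul]
  have h1 : ∀ i, ((Finset.univ.filter fun j => x j = x i).card : ℝ≥0∞)⁻¹ *
      π.restrict (Prod.fst ⁻¹' {x i}) s = ∫⁻ z in s,
        ((Finset.univ.filter fun j => x j = x i).card : ℝ≥0∞)⁻¹ *
          (Prod.fst ⁻¹' {x i}).indicator 1 z ∂π := by
    intro i
    rw [lintegral_const_mul _ (measurable_one.indicator (hA i)), lintegral_indicator_one (hA i),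
      Measure.restrict_apply hs, Measure.restrict_apply (hA i), Set.inter_comm]
  simp_rw [h1]
  rw [← lintegral_finsetSum _ fun i _ => (measurable_one.indicator (hA i)).const_mul _]
  conv_rhs => rw [← setLIntegral_one]
  refine lintegral_congr_ae ((ae_restrict_of_ae (ae_mem_range_of_map_fst h)).mono fun z hz => ?_)
  obtain ⟨k, hk⟩ := hz
  have h2 : ∀ i, ((Finset.univ.filter fun j => x j = x i).card : ℝ≥0∞)⁻¹ *
      (Prod.fst ⁻¹' {x i}).indicator 1 z =
        if x i = x k then ((Finset.univ.filter fun j => x j = x k).card : ℝ≥0∞)⁻¹ else 0 := by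
    intro i
    by_cases hi : x i = x k
    · simp [hi, hk]
    · have : z.1 ≠ x i := fun h => hi (by rw [← h, hk])
      simp [hi, this]
  simp only [h2]
  rw [Finset.sum_ite, Finset.sum_const_zero, add_zero, Finset.sum_const, nsmul_eq_mul,
    ENNReal.mul_inv_cancel]
  · have : k ∈ Finset.univ.filter fun j => x j = x k := by simp
    exact Nat.cast_ne_zero.2 (Finset.card_ne_zero_of_mem this)
  · exact ENNReal.natCast_ne_top _

theorem lintegral_dirac_prod (v : EuclideanSpace ℝ (Fin d))
    (ρ : Measure (EuclideanSpace ℝ (Fin d))) [SFinite ρ] :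
    ∫⁻ z, ‖z.1 - z.2‖ₑ ^ 2 ∂((Measure.dirac v).prod ρ) = ∫⁻ y, ‖v - y‖ₑ ^ 2 ∂ρ := by
  rw [Measure.dirac_prod, lintegral_map (by fun_prop) (by fun_prop)]

/-- Transport from an empirical measure amounts to a splitting of the target measure. -/
theorem wassersteinSq_empiricalMeasure (x : Fin n → EuclideanSpace ℝ (Fin d))
    (P : Measure (EuclideanSpace ℝ (Fin d))) [IsFiniteMeasure P] :
    wassersteinSq (empiricalMeasure x) P =
      ⨅ ρ : {ρ : Fin n → Measure (EuclideanSpace ℝ (Fin d)) //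
        (∀ i, ρ i Set.univ = (n : ℝ≥0∞)⁻¹) ∧ ∑ i, ρ i = P},
        ∑ i, ∫⁻ y, ‖x i - y‖ₑ ^ 2 ∂(ρ.1 i) := by
  refine le_antisymm (le_iInf ?_) (le_iInf ?_)
  · rintro ⟨ρ, hρ, rfl⟩
    have hfin : ∀ i, IsFiniteMeasure (ρ i) := fun i =>
      isFiniteMeasure_of_le (∑ i, ρ i) (Finset.single_le_sum (f := ρ)
        (fun _ _ => Measure.zero_le _) (Finset.mem_univ i))
    have hc : IsCoupling (∑ i, (Measure.dirac (x i)).prod (ρ i)) (empiricalMeasure x)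
        (∑ i, ρ i) := by
      constructor
      · rw [← Measure.sum_fintype, Measure.map_sum measurable_fst.aemeasurable,
          Measure.sum_fintype, empiricalMeasure, Finset.smul_sum]
        simp [Measure.map_fst_prod, hρ]
      · rw [← Measure.sum_fintype, Measure.map_sum measurable_snd.aemeasurable,
          Measure.sum_fintype]
        simp [Measure.map_snd_prod]
    refine (wassersteinSq_le hc).trans (le_of_eq ?_)
    rw [lintegral_finsetSum_measure]
    exact Finset.sum_congr rfl fun i _ => lintegral_dirac_prod _ _
  · rintro ⟨π, h1, h2⟩
    have hA : ∀ i, MeasurableSet (Prod.fst ⁻¹' {x i} :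
        Set (EuclideanSpace ℝ (Fin d) × EuclideanSpace ℝ (Fin d))) := fun i =>
      measurable_fst (measurableSet_singleton _)
    set c : Fin n → ℝ≥0∞ := fun i => (Finset.univ.filter fun j => x j = x i).card with hc
    set ρ : Fin n → Measure (EuclideanSpace ℝ (Fin d)) := fun i =>
      (c i)⁻¹ • (π.restrict (Prod.fst ⁻¹' {x i})).map Prod.snd with hρ
    have hsum : ∑ i, (c i)⁻¹ • π.restrict (Prod.fst ⁻¹' {x i}) = π :=
      sum_inv_card_smul_restrict h1
    have hmass : ∀ i, ρ i Set.univ = (n : ℝ≥0∞)⁻¹ := by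
      intro i
      have hci : c i ≠ 0 := by
        have : i ∈ Finset.univ.filter fun j => x j = x i := by simp
        exact Nat.cast_ne_zero.2 (Finset.card_ne_zero_of_mem this)
      rw [hρ]
      simp only [Measure.smul_apply, smul_eq_mul]
      rw [Measure.map_apply measurable_snd .univ, Set.preimage_univ, Measure.restrict_apply_univ,
        ← Measure.map_apply measurable_fst (measurableSet_singleton _), h1,
        empiricalMeasure_singleton, mul_left_comm,
        ENNReal.inv_mul_cancel hci (ENNReal.natCast_ne_top _), mul_one]
    have hP : ∑ i, ρ i = P := by
      rw [← h2]
      conv_rhs => rw [← hsum, ← Measure.sum_fintype, Measure.map_sum measurable_snd.aemeasurable,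
        Measure.sum_fintype]
      simp only [hρ, Measure.map_smul]
    refine (iInf_le _ ⟨ρ, hmass, hP⟩).trans (le_of_eq ?_)
    change _ = ∫⁻ z, ‖z.1 - z.2‖ₑ ^ 2 ∂π
    conv_rhs => rw [← hsum]
    rw [lintegral_finsetSum_measure]
    refine Finset.sum_congr rfl fun i _ => ?_
    simp only [hρ, lintegral_smul_measure]
    rw [lintegral_map (by fun_prop) measurable_snd]
    congr 1
    refine setLIntegral_congr_fun (hA i) fun z hz => ?_
    have hz : z.1 = x i := hz
    simp only [hz]

theorem continuous_lintegral_enorm_sub_sq {ρ : Measure (EuclideanSpace ℝ (Fin d))}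
    [IsFiniteMeasure ρ] (h : ∫⁻ y, ‖y‖ₑ ^ 2 ∂ρ ≠ ∞) :
    Continuous fun v => ∫⁻ y, ‖v - y‖ₑ ^ 2 ∂ρ := by
  rw [continuous_iff_continuousAt]
  intro v
  refine tendsto_lintegral_filter_of_dominated_convergence
    (fun y => 2 * ((‖v‖ₑ + 1) ^ 2 + ‖y‖ₑ ^ 2)) (Filter.Eventually.of_forall fun w => by fun_prop)
    ?_ ?_ ?_
  · have hw : ∀ᶠ w in nhds v, ‖w‖ₑ < ‖v‖ₑ + 1 :=
      continuous_enorm.continuousAt.eventually_lt continuousAt_const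
        (ENNReal.lt_add_right (by simp) (by simp))
    filter_upwards [hw] with w hw
    refine ae_of_all _ fun y => (enorm_sub_sq_le w y).trans ?_
    gcongr
  · rw [lintegral_const_mul _ (by fun_prop), lintegral_add_left (by fun_prop), lintegral_const]
    refine ENNReal.mul_ne_top (by simp) (ENNReal.add_ne_top.2 ⟨?_, h⟩)
    exact ENNReal.mul_ne_top (by simp) (measure_ne_top _ _)
  · refine ae_of_all _ fun y => ?_
    have : Continuous fun w : EuclideanSpace ℝ (Fin d) => ‖w - y‖ₑ ^ 2 := by fun_prop
    exact this.continuousAt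

/-- The admissible splittings of `P` do not depend on the sample, so the cost is an infimum over a
fixed set of functions continuous in `x`. It is therefore upper semicontinuous, even though the set
is uncountable. -/
theorem measurable_wassersteinSq_empiricalMeasure {P : Measure (EuclideanSpace ℝ (Fin d))}
    [IsFiniteMeasure P] (h : ∫⁻ y, ‖y‖ₑ ^ 2 ∂P ≠ ∞) :
    Measurable fun x : Fin n → EuclideanSpace ℝ (Fin d) =>
      wassersteinSq (empiricalMeasure x) P := by
  simp_rw [wassersteinSq_empiricalMeasure]
  refine (upperSemicontinuous_iInf fun ρ => Continuous.upperSemicontinuous ?_).measurable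
  obtain ⟨ρ, -, hρ⟩ := ρ
  refine continuous_finsetSum _ fun i _ => ?_
  have hle : ρ i ≤ P := hρ ▸ Finset.single_le_sum (f := ρ)
    (fun _ _ => Measure.zero_le _) (Finset.mem_univ i)
  have : IsFiniteMeasure (ρ i) := isFiniteMeasure_of_le P hle
  exact (continuous_lintegral_enorm_sub_sq
    (ne_top_of_le_ne_top h (lintegral_mono' hle le_rfl))).comp (continuous_apply i)

theorem enorm_sub_nearestNeighbor [NeZero n] (x : Fin n → EuclideanSpace ℝ (Fin d))
    (z : EuclideanSpace ℝ (Fin d)) : ‖z - nearestNeighbor x z‖ₑ = ⨅ i, ‖z - x i‖ₑ := by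
  refine le_antisymm (le_iInf fun i => ?_) ?_
  · rw [enorm_le_iff_norm_le]
    exact norm_sub_nearestNeighbor_le x z i
  · obtain ⟨i, hi⟩ := nearestNeighbor_mem x z
    rw [← hi]
    exact iInf_le _ i

theorem measurable_e₂ [NeZero n] (P : Measure (EuclideanSpace ℝ (Fin d))) [SFinite P] :
    Measurable fun x : Fin n → EuclideanSpace ℝ (Fin d) => e₂ P x := by
  simp only [e₂, enorm_sub_nearestNeighbor]
  refine Measurable.lintegral_prod_right (f := fun (x : Fin n → EuclideanSpace ℝ (Fin d))
    (z : EuclideanSpace ℝ (Fin d)) => (⨅ i, ‖z - x i‖ₑ) ^ 2) ?_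
  refine Measurable.pow_const (Measurable.iInf fun i => ?_) 2
  fun_prop

/-- Under any coupling the first coordinate is almost surely a sample point, so it is no closer to
the second than the nearest neighbour is. -/
theorem e₂_le_wassersteinSq [NeZero n] (P : Measure (EuclideanSpace ℝ (Fin d)))
    (x : Fin n → EuclideanSpace ℝ (Fin d)) : e₂ P x ≤ wassersteinSq (empiricalMeasure x) P := by
  refine le_iInf fun ⟨π, h1, h2⟩ => ?_
  simp only [e₂, enorm_sub_nearestNeighbor]
  conv_lhs => rw [← h2]
  rw [lintegral_map ?_ measurable_snd]
  · refine lintegral_mono_ae ((ae_mem_range_of_map_fst h1).mono fun z hz => ?_)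
    obtain ⟨i, hi⟩ := hz
    rw [← hi, enorm_sub_rev (x i)]
    gcongr
    exact iInf_le _ i
  · refine Measurable.pow_const (Measurable.iInf fun i => ?_) 2
    fun_prop

end EmpiricalTransport

/-- Quantiles for a law that may have atoms: the set of `t` with at most mass `a` strictly below
them still carries mass `a`, if that much is available. It is needed because distances from a fixed
point can have atoms even when `P` has none. -/
theorem min_le_measure_quantile_set {ν : Measure ℝ} [IsFiniteMeasure ν] (hν : ν (Set.Iio 0) = 0)
    (a : ℝ≥0∞) : min a (ν Set.univ) ≤ ν {t | ν (Set.Iio t) ≤ a} := by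
  set T : Set ℝ := {t | ν (Set.Iio t) ≤ a} with hT
  rcases Set.eq_empty_or_nonempty Tᶜ with h | hne
  · rw [Set.compl_empty_iff.1 h]
    exact min_le_right _ _
  refine (min_le_left _ _).trans ?_
  have hbdd : BddBelow Tᶜ := by
    refine ⟨0, fun t ht => le_of_not_gt fun h0 => ht ?_⟩
    have : ν (Set.Iio t) ≤ 0 := hν ▸ measure_mono (Set.Iio_subset_Iio h0.le)
    exact this.trans zero_le
  have hgt : ∀ t ∈ Tᶜ, a < ν (Set.Iio t) := fun t ht => not_le.1 (by simpa [hT] using ht)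
  have hglb := isGLB_csInf hne hbdd
  set b := sInf Tᶜ
  have hlt : ∀ s < b, s ∈ T := fun s hs => by
    by_contra h
    exact absurd (hglb.1 h) (not_le.2 hs)
  -- `T` is a half-line ending at `b`. If it contains `b`, its mass is the limit of the masses below
  -- points of `Tᶜ` decreasing to `b`; if not, it contains `Iio b`, whose mass exceeds `a`.
  by_cases hb : b ∈ T
  · obtain ⟨u, hu, -, hlim, hmem⟩ := hglb.exists_seq_antitone_tendsto hne
    calc a ≤ ⨅ k, ν (Set.Iio (u k)) := le_iInf fun k => (hgt _ (hmem k)).le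
      _ = ν (⋂ k, Set.Iio (u k)) := by
        refine (Antitone.measure_iInter (fun i j hij => Set.Iio_subset_Iio (hu hij))
          (fun k => measurableSet_Iio.nullMeasurableSet) ⟨0, measure_ne_top _ _⟩).symm
      _ ≤ ν T := by
        refine measure_mono fun s hs => ?_
        have hsb : s ≤ b := ge_of_tendsto' hlim fun k => (Set.mem_iInter.1 hs k).le
        rcases hsb.lt_or_eq with h | rfl
        · exact hlt s h
        · exact hb
  · exact (hgt b hb).le.trans (measure_mono hlt)

/-! ### Narrow cones around a point. -/

section Cones

variable {d : ℕ}

/-- The cone with apex `x` of the points whose direction from `x` is within `1 / 2` of `a`. -/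
def cone (a x : EuclideanSpace ℝ (Fin d)) : Set (EuclideanSpace ℝ (Fin d)) :=
  {z | z ≠ x ∧ dist (‖z - x‖⁻¹ • (z - x)) a < 1 / 2}

/-- Compactness of the unit sphere. The number of cones depends on `d` alone. -/
theorem exists_finset_cone_cover (d : ℕ) : ∃ s : Finset (EuclideanSpace ℝ (Fin d)),
    ∀ x z, z ≠ x → ∃ a ∈ s, z ∈ cone a x := by
  obtain ⟨t, -, hfin, hcov⟩ := (isCompact_sphere (0 : EuclideanSpace ℝ (Fin d)) 1).finite_cover_balls
    (one_half_pos (α := ℝ))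
  refine ⟨hfin.toFinset, fun x z hz => ?_⟩
  have hmem : ‖z - x‖⁻¹ • (z - x) ∈ Metric.sphere (0 : EuclideanSpace ℝ (Fin d)) 1 := by
    rw [mem_sphere_zero_iff_norm, norm_smul, norm_inv, norm_norm,
      inv_mul_cancel₀ (norm_ne_zero_iff.2 (sub_ne_zero.2 hz))]
  obtain ⟨a, ha, hd⟩ := Set.mem_iUnion₂.1 (hcov hmem)
  exact ⟨a, hfin.mem_toFinset.2 ha, hz, hd⟩

/-- The unit directions `u` of `z - x` and `v` of `y - x` are less than 1 apart, both being within
`1 / 2` of `a`. Writing `z - y` as `(‖z - x‖ - ‖y - x‖) • u + ‖y - x‖ • (u - v)` and using the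
triangle inequality gives the strict bound. -/
theorem norm_sub_lt_of_mem_cone {a x y z : EuclideanSpace ℝ (Fin d)} (hy : y ∈ cone a x)
    (hz : z ∈ cone a x) (h : ‖y - x‖ ≤ ‖z - x‖) : ‖z - y‖ < ‖z - x‖ := by
  have hy0 : 0 < ‖y - x‖ := norm_pos_iff.2 (sub_ne_zero.2 hy.1)
  have hz0 : 0 < ‖z - x‖ := norm_pos_iff.2 (sub_ne_zero.2 hz.1)
  set u := ‖z - x‖⁻¹ • (z - x) with hu
  set v := ‖y - x‖⁻¹ • (y - x) with hv
  have huv : ‖u - v‖ < 1 := by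
    rw [← dist_eq_norm]
    calc _ ≤ dist u a + dist v a := dist_triangle_right u v a
      _ < 1 := by have := hy.2; have := hz.2; linarith
  have hu1 : ‖u‖ = 1 := by
    rw [hu, norm_smul, norm_inv, norm_norm, inv_mul_cancel₀ hz0.ne']
  have hzu : z - x = ‖z - x‖ • u := (smul_inv_smul₀ hz0.ne' _).symm
  have hyv : y - x = ‖y - x‖ • v := (smul_inv_smul₀ hy0.ne' _).symm
  have key : z - y = (‖z - x‖ - ‖y - x‖) • u + ‖y - x‖ • (u - v) := by
    calc z - y = (z - x) - (y - x) := by abel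
      _ = ‖z - x‖ • u - ‖y - x‖ • v := by rw [← hzu, ← hyv]
      _ = _ := by rw [sub_smul, smul_sub]; abel
  clear_value u v
  calc ‖z - y‖ ≤ (‖z - x‖ - ‖y - x‖) * 1 + ‖y - x‖ * ‖u - v‖ := by
        rw [key]
        refine (norm_add_le _ _).trans ?_
        rw [norm_smul, norm_smul, hu1, Real.norm_of_nonneg (sub_nonneg.2 h), norm_norm]
    _ < (‖z - x‖ - ‖y - x‖) * 1 + ‖y - x‖ * 1 := by gcongr
    _ = ‖z - x‖ := by ring

theorem measurableSet_cone_prod (a : EuclideanSpace ℝ (Fin d)) :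
    MeasurableSet {p : EuclideanSpace ℝ (Fin d) × EuclideanSpace ℝ (Fin d) |
      p.2 ∈ cone a p.1} := by
  have h : {p : EuclideanSpace ℝ (Fin d) × EuclideanSpace ℝ (Fin d) | p.2 ∈ cone a p.1} =
      {p | p.2 = p.1}ᶜ ∩ {p | dist (‖p.2 - p.1‖⁻¹ • (p.2 - p.1)) a < 1 / 2} := by
    ext p
    simp [cone]
  rw [h]
  refine MeasurableSet.inter (measurableSet_eq_fun measurable_snd measurable_fst).compl ?_
  exact measurableSet_lt (Measurable.dist (by fun_prop) measurable_const) measurable_const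

theorem measurableSet_cone (a x : EuclideanSpace ℝ (Fin d)) : MeasurableSet (cone a x) :=
  (measurableSet_cone_prod a).preimage (measurable_prodMk_left (x := x))

end Cones

/-! ### Mass of the Voronoi cells. -/

section Voronoi

variable {d n : ℕ} {P : Measure (EuclideanSpace ℝ (Fin d))}

theorem measurableSet_voronoiCell_prod (i : Fin n) :
    MeasurableSet {p : (Fin n → EuclideanSpace ℝ (Fin d)) × EuclideanSpace ℝ (Fin d) |
      p.2 ∈ voronoiCell p.1 i} := by
  have h : {p : (Fin n → EuclideanSpace ℝ (Fin d)) × EuclideanSpace ℝ (Fin d) |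
      p.2 ∈ voronoiCell p.1 i} =
        ⋂ j, ⋂ (_ : j ≠ i), {p | ‖p.2 - p.1 i‖ ≤ ‖p.2 - p.1 j‖} := by
    ext p
    simp [voronoiCell]
  rw [h]
  exact MeasurableSet.iInter fun j => MeasurableSet.iInter fun _ =>
    measurableSet_le (by fun_prop) (by fun_prop)

theorem measurable_e₃ [SFinite P] :
    Measurable fun x : Fin n → EuclideanSpace ℝ (Fin d) => e₃ P x :=
  Measurable.iSup fun i => measurable_measure_prodMk_left (measurableSet_voronoiCell_prod i)

theorem measurable_measure_voronoiCell_inter_cone [SFinite P] (i : Fin n)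
    (a : EuclideanSpace ℝ (Fin d)) :
    Measurable fun x : Fin n → EuclideanSpace ℝ (Fin d) =>
      P (voronoiCell x i ∩ cone a (x i)) := by
  refine measurable_measure_prodMk_left (s := {p : (Fin n → EuclideanSpace ℝ (Fin d)) ×
    EuclideanSpace ℝ (Fin d) | p.2 ∈ voronoiCell p.1 i} ∩ {p | p.2 ∈ cone a (p.1 i)})
    ((measurableSet_voronoiCell_prod i).inter ?_)
  have h : Measurable fun p : (Fin n → EuclideanSpace ℝ (Fin d)) × EuclideanSpace ℝ (Fin d) =>
      (p.1 i, p.2) := by fun_prop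
  exact (measurableSet_cone_prod a).preimage h

/-- `G` is the part of the cone nearest to `x`, up to mass `α`. A second sample point in `G`
confines the cell of `x`, inside the cone, to a region of mass at most `α`. -/
theorem exists_set_voronoiCell_inter_cone_le [IsFiniteMeasure P]
    (a x : EuclideanSpace ℝ (Fin d)) (α : ℝ≥0∞) :
    ∃ G, MeasurableSet G ∧ min α (P (cone a x)) ≤ P G ∧
      ∀ y ∈ G, ∀ V : Set (EuclideanSpace ℝ (Fin d)), (∀ z ∈ V, ‖z - x‖ ≤ ‖z - y‖) →
        P (V ∩ cone a x) ≤ α := by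
  set C := cone a x
  have hC : MeasurableSet C := measurableSet_cone a x
  set f : EuclideanSpace ℝ (Fin d) → ℝ := fun z => ‖z - x‖ with hf
  have hfm : Measurable f := by fun_prop
  set ν := (P.restrict C).map f with hν
  have hT : MeasurableSet {t | ν (Set.Iio t) ≤ α} := by
    have hm : Monotone fun t => ν (Set.Iio t) := fun s t h => measure_mono (Set.Iio_subset_Iio h)
    exact measurableSet_le hm.measurable measurable_const
  refine ⟨f ⁻¹' {t | ν (Set.Iio t) ≤ α} ∩ C, (hfm hT).inter hC, ?_, ?_⟩
  · have h0 : ν (Set.Iio 0) = 0 := by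
      rw [hν, Measure.map_apply hfm measurableSet_Iio]
      have : f ⁻¹' Set.Iio 0 = ∅ := by
        ext z
        simp [hf]
      simp [this]
    have h := min_le_measure_quantile_set h0 α
    have huniv : ν Set.univ = P C := by
      rw [hν, Measure.map_apply hfm .univ, Set.preimage_univ, Measure.restrict_apply_univ]
    have hG : ν {t | ν (Set.Iio t) ≤ α} = P (f ⁻¹' {t | ν (Set.Iio t) ≤ α} ∩ C) := by
      conv_lhs => rw [hν]
      rw [Measure.map_apply hfm hT, Measure.restrict_apply (hfm hT)]
    rwa [huniv, hG] at h
  · intro y hy V hV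
    refine le_trans (measure_mono ?_) (le_of_eq_of_le ?_ hy.1 : P (f ⁻¹' Set.Iio (f y) ∩ C) ≤ α)
    -- A point of `V` in the cone and at least as far from `x` as `y` would be strictly closer to
    -- `y` than to `x`.
    · rintro z ⟨hzV, hzC⟩
      refine ⟨Set.mem_preimage.2 (Set.mem_Iio.2 (lt_of_not_ge fun h => ?_)), hzC⟩
      exact absurd (norm_sub_lt_of_mem_cone hy.2 hzC h) (not_lt.2 (hV z hzV))
    · rw [hν, Measure.map_apply hfm measurableSet_Iio,
        Measure.restrict_apply (hfm measurableSet_Iio)]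

/-- Condition on the `i`-th point. The event is empty if its cone has mass at most `α`; otherwise it
forces the `n` other independent points to avoid a set of mass at least `α`. -/
theorem measure_voronoiCell_inter_cone_gt_le [IsProbabilityMeasure P] (i : Fin (n + 1))
    (a : EuclideanSpace ℝ (Fin d)) (α : ℝ≥0∞) :
    Measure.pi (fun _ : Fin (n + 1) => P) {x | α < P (voronoiCell x i ∩ cone a (x i))} ≤
      (1 - α) ^ n := by
  have hmp := (measurePreserving_piFinSuccAbove (fun _ : Fin (n + 1) => P) i).symm
  have hm : MeasurableSet {x : Fin (n + 1) → EuclideanSpace ℝ (Fin d) |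
      α < P (voronoiCell x i ∩ cone a (x i))} :=
    measurableSet_lt measurable_const (measurable_measure_voronoiCell_inter_cone i a)
  rw [← hmp.measure_preimage hm.nullMeasurableSet, Measure.prod_apply (hmp.measurable hm)]
  refine (lintegral_mono (g := fun _ => (1 - α) ^ n) fun x => ?_).trans (by simp)
  obtain ⟨G, hGm, hG, hle⟩ := exists_set_voronoiCell_inter_cone_le (P := P) a x α
  by_cases hC : P (cone a x) ≤ α
  · refine le_of_eq_of_le ?_ zero_le
    convert measure_empty (μ := Measure.pi fun _ : Fin n => P)
    ext y
    simp only [Set.mem_preimage, Set.mem_ofPred_eq, Set.mem_empty_iff_false, iff_false, not_lt]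
    refine (measure_mono Set.inter_subset_right).trans (le_of_eq_of_le ?_ hC)
    congr 2
    exact Fin.insertNth_apply_same (α := fun _ => EuclideanSpace ℝ (Fin d)) i x y
  · rw [min_eq_left (not_le.1 hC).le] at hG
    calc _ ≤ Measure.pi (fun _ : Fin n => P) (Set.univ.pi fun _ => Gᶜ) := by
          refine measure_mono fun y hy k _ hk => ?_
          simp only [Set.mem_preimage, Set.mem_ofPred_eq] at hy
          have hx : (MeasurableEquiv.piFinSuccAbove (fun _ => EuclideanSpace ℝ (Fin d)) i).symm
            (x, y) i = x :=
              Fin.insertNth_apply_same (α := fun _ => EuclideanSpace ℝ (Fin d)) i x y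
          have hyk : (MeasurableEquiv.piFinSuccAbove (fun _ => EuclideanSpace ℝ (Fin d)) i).symm
            (x, y) (i.succAbove k) = y k :=
              Fin.insertNth_apply_succAbove (α := fun _ => EuclideanSpace ℝ (Fin d)) i x y k
          rw [hx] at hy
          refine absurd hy (not_lt.2 (hle (y k) hk _ fun z hz => ?_))
          have := hz (i.succAbove k) (Fin.succAbove_ne i k)
          rwa [hx, hyk] at this
      _ = (1 - P G) ^ n := by
          rw [Measure.pi_pi]
          simp [prob_compl_eq_one_sub hGm]
      _ ≤ _ := pow_le_pow_left' (tsub_le_tsub_left hG 1) n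

theorem e₃_le_one [IsProbabilityMeasure P] (x : Fin n → EuclideanSpace ℝ (Fin d)) : e₃ P x ≤ 1 :=
  iSup_le fun _ => prob_le_one

theorem measure_voronoiCell_le_sum [NullSingletonClass P] {s : Finset (EuclideanSpace ℝ (Fin d))}
    (hs : ∀ x z, z ≠ x → ∃ a ∈ s, z ∈ cone a x) (x : Fin n → EuclideanSpace ℝ (Fin d))
    (i : Fin n) : P (voronoiCell x i) ≤ ∑ a ∈ s, P (voronoiCell x i ∩ cone a (x i)) := by
  calc _ ≤ P ({x i} ∪ ⋃ a ∈ s, voronoiCell x i ∩ cone a (x i)) := by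
        refine measure_mono fun z hz => ?_
        by_cases h : z = x i
        · exact Or.inl h
        · obtain ⟨a, ha, hza⟩ := hs (x i) z h
          exact Or.inr (Set.mem_iUnion₂.2 ⟨a, ha, hz, hza⟩)
    _ ≤ P {x i} + P (⋃ a ∈ s, voronoiCell x i ∩ cone a (x i)) := measure_union_le _ _
    _ ≤ _ := by
        rw [measure_singleton, zero_add]
        exact measure_biUnion_finset_le _ _

theorem lintegral_e₃_sq_le [IsProbabilityMeasure P] [NullSingletonClass P]
    {s : Finset (EuclideanSpace ℝ (Fin d))} (hs : ∀ x z, z ≠ x → ∃ a ∈ s, z ∈ cone a x)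
    (α : ℝ≥0∞) :
    ∫⁻ x, e₃ P x ^ 2 ∂(Measure.pi fun _ : Fin (n + 1) => P) ≤
      (s.card * α) ^ 2 + (n + 1) * s.card * (1 - α) ^ n := by
  let A : Fin (n + 1) → EuclideanSpace ℝ (Fin d) → Set (Fin (n + 1) → EuclideanSpace ℝ (Fin d)) :=
    fun i a => {x | α < P (voronoiCell x i ∩ cone a (x i))}
  have hA : ∀ i a, MeasurableSet (A i a) := fun i a =>
    measurableSet_lt measurable_const (measurable_measure_voronoiCell_inter_cone i a)
  have hpt : ∀ x, e₃ P x ^ 2 ≤ (s.card * α) ^ 2 +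
      ∑ i, ∑ a ∈ s, (A i a).indicator (fun _ => (1 : ℝ≥0∞)) x := by
    intro x
    -- On a bad event the trivial bound `e₃ ≤ 1` is paid for by one indicator; otherwise each cell
    -- has mass at most `α` in each cone.
    by_cases h : ∃ i, ∃ a ∈ s, x ∈ A i a
    · obtain ⟨i, a, ha, hx⟩ := h
      refine le_trans ?_ le_add_self
      calc _ ≤ (1 : ℝ≥0∞) := pow_le_one₀ zero_le (e₃_le_one x)
        _ = (A i a).indicator (fun _ => (1 : ℝ≥0∞)) x := by rw [Set.indicator_of_mem hx]
        _ ≤ ∑ a ∈ s, (A i a).indicator (fun _ => (1 : ℝ≥0∞)) x :=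
          Finset.single_le_sum (f := fun a => (A i a).indicator (fun _ => (1 : ℝ≥0∞)) x)
            (fun _ _ => zero_le) ha
        _ ≤ _ := Finset.single_le_sum
            (f := fun i => ∑ a ∈ s, (A i a).indicator (fun _ => (1 : ℝ≥0∞)) x)
            (fun _ _ => zero_le) (Finset.mem_univ i)
    · push Not at h
      refine le_trans (pow_le_pow_left' (iSup_le fun i => ?_) 2) le_self_add
      refine (measure_voronoiCell_le_sum hs x i).trans ?_
      rw [← nsmul_eq_mul]
      exact Finset.sum_le_card_nsmul _ _ _ fun a ha => not_lt.1 (h i a ha)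
  refine (lintegral_mono hpt).trans ?_
  rw [lintegral_add_left measurable_const, lintegral_const, measure_univ, mul_one]
  gcongr
  rw [lintegral_finsetSum _ fun i _ => Finset.measurable_sum _ fun a _ =>
    measurable_const.indicator (hA i a)]
  calc _ ≤ ∑ _i : Fin (n + 1), ∑ _a ∈ s, (1 - α) ^ n := by
        refine Finset.sum_le_sum fun i _ => ?_
        rw [lintegral_finsetSum _ fun a _ => measurable_const.indicator (hA i a)]
        refine Finset.sum_le_sum fun a _ => ?_
        rw [lintegral_indicator_const (hA i a), one_mul]
        exact measure_voronoiCell_inter_cone_gt_le i a α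
    _ = _ := by simp [mul_assoc]

theorem lintegral_e₃_sq_le_log [IsProbabilityMeasure P] [NullSingletonClass P]
    {s : Finset (EuclideanSpace ℝ (Fin d))} (hs : ∀ x z, z ≠ x → ∃ a ∈ s, z ∈ cone a x)
    (hn : 2 ≤ n) :
    ∫⁻ x, e₃ P x ^ 2 ∂(Measure.pi fun _ : Fin n => P) ≤
      ENNReal.ofReal ((36 * s.card ^ 2 + 3 * s.card) * (Real.log n / n) ^ 2) := by
  obtain ⟨k, rfl⟩ : ∃ k, n = k + 1 := ⟨n - 1, by omega⟩
  have hk : (1 : ℝ) ≤ k := by exact_mod_cast (by omega : 1 ≤ k)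
  set N : ℝ := ((k + 1 : ℕ) : ℝ) with hN
  have hNk : N = k + 1 := by rw [hN]; push_cast; ring
  have hN2 : 2 ≤ N := by linarith
  set l := Real.log N with hl
  have hlog : 0.69 < l := by
    have : Real.log 2 ≤ l := Real.log_le_log (by norm_num) hN2
    have := Real.log_two_gt_d9
    linarith
  -- With `α = 6 log N / N` and `k / N ≥ 1 / 2`, the failure probability is at most `exp (-3 log
  -- N)`. The cube leaves `N ^ (-2)` after the union bound over `N` cells.
  have hpow : (1 - ENNReal.ofReal (6 * (l / N))) ^ k ≤ ENNReal.ofReal (1 / N ^ 3) := by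
    calc _ ≤ ENNReal.ofReal (Real.exp (-(6 * (l / N)))) ^ k := by
          gcongr
          rw [← ENNReal.ofReal_one, ← ENNReal.ofReal_sub _ (by positivity)]
          exact ENNReal.ofReal_le_ofReal (Real.one_sub_le_exp_neg _)
      _ = ENNReal.ofReal (Real.exp (k * -(6 * (l / N)))) := by
          rw [← ENNReal.ofReal_pow (Real.exp_pos _).le, ← Real.exp_nat_mul]
      _ ≤ ENNReal.ofReal (Real.exp (-(3 * l))) := by
          gcongr
          have h2 : 1 / 2 * N ≤ k := by linarith
          have h3 : 1 / 2 ≤ k / N := (le_div_iff₀ (by linarith)).2 h2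
          have h4 : (k : ℝ) * -(6 * (l / N)) = -(6 * l * (k / N)) := by ring
          rw [h4]
          nlinarith
      _ = ENNReal.ofReal (1 / N ^ 3) := by
          rw [Real.exp_neg, mul_comm, Real.exp_mul, hl, Real.exp_log (by linarith), one_div]
          norm_cast
  refine (lintegral_e₃_sq_le hs (ENNReal.ofReal (6 * (l / N)))).trans ?_
  calc _ ≤ (s.card * ENNReal.ofReal (6 * (l / N))) ^ 2 +
        (k + 1) * s.card * ENNReal.ofReal (1 / N ^ 3) := by gcongr
    _ = ENNReal.ofReal ((s.card * (6 * (l / N))) ^ 2 + N * s.card * (1 / N ^ 3)) := by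
        rw [ENNReal.ofReal_add (by positivity) (by positivity), ENNReal.ofReal_pow (by positivity),
          ENNReal.ofReal_mul (p := (s.card : ℝ)) (by positivity), ENNReal.ofReal_natCast,
          ENNReal.ofReal_mul (p := N * s.card) (by positivity),
          ENNReal.ofReal_mul (p := N) (by positivity), ENNReal.ofReal_natCast, hN,
          ENNReal.ofReal_natCast]
        push_cast
        rfl
    _ ≤ _ := by
        refine ENNReal.ofReal_le_ofReal ?_
        have h1 : N * s.card * (1 / N ^ 3) = s.card * (1 / N ^ 2) := by field_simp
        -- Holds because `3 * (log 2) ^ 2 > 1`.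
        have h2 : 1 / N ^ 2 ≤ 3 * (l / N) ^ 2 := by
          rw [div_pow, ← mul_div_assoc]
          gcongr
          nlinarith
        rw [h1]
        have : (0 : ℝ) ≤ s.card := Nat.cast_nonneg _
        nlinarith [mul_le_mul_of_nonneg_left h2 this]

end Voronoi

/-! ### Passage to random samples and assembly of the three bounds. -/

section Main

variable {d n : ℕ} {Ω : Type*} [MeasurableSpace Ω] {μ : Measure Ω}
  {P : Measure (EuclideanSpace ℝ (Fin d))}
  {X : Fin n → Ω → EuclideanSpace ℝ (Fin d)}

theorem rpow_moment_ne_top {r : ℝ} (hr : 4 < r) (M : ℝ≥0) : (M : ℝ≥0∞) ^ r ≠ ∞ :=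
  ENNReal.rpow_ne_top_of_nonneg (by linarith) ENNReal.coe_ne_top

/-- Independence makes the joint law of the sample a product measure, on which the Voronoi estimate
was proved. -/
theorem lintegral_comp_sample [IsProbabilityMeasure μ] (hind : iIndepFun X μ) (hX : ∀ i, HasLaw (X i) P μ)
    {f : (Fin n → EuclideanSpace ℝ (Fin d)) → ℝ≥0∞} (hf : Measurable f) :
    ∫⁻ ω, f (fun i => X i ω) ∂μ = ∫⁻ x, f x ∂(Measure.pi fun _ => P) := by
  have h := (iIndepFun_iff_map_fun_eq_pi_map fun i => (hX i).aemeasurable).1 hind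
  simp only [fun i => (hX i).map_eq] at h
  rw [← h, lintegral_map' hf.aemeasurable
    (aemeasurable_pi_lambda _ fun i => (hX i).aemeasurable)]

variable [IsProbabilityMeasure P]

theorem aemeasurable_wassersteinSq {r : ℝ} (hr : 4 < r) {M : ℝ≥0}
    (hP : ∫⁻ x, ‖x‖ₑ ^ r ∂P ≤ (M : ℝ≥0∞) ^ r) (hX : ∀ i, HasLaw (X i) P μ) :
    AEMeasurable (fun ω => wassersteinSq (empiricalMeasure fun i => X i ω) P) μ := by
  have h2 : ∫⁻ y, ‖y‖ₑ ^ 2 ∂P ≠ ∞ := by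
    refine ne_top_of_le_ne_top (shellBound_ne_top hr (rpow_moment_ne_top hr M)) ?_
    exact (lintegral_mono enorm_sq_le_shell).trans (lintegral_four_pow_shell_le (by linarith) hP)
  exact (measurable_wassersteinSq_empiricalMeasure h2).comp_aemeasurable
    (aemeasurable_pi_lambda _ fun i => (hX i).aemeasurable)

variable [IsProbabilityMeasure μ]

/-- The constant in the rate of convergence of the empirical measure. -/
def wassersteinConst (d : ℕ) (r : ℝ) (M : ℝ≥0) : ℝ :=
  2 * ((4 * d) ^ 2 + (64 * d * (2 ^ d) ^ (1 / 2 : ℝ)) ^ 2) *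
    (shellBound r ((M : ℝ≥0∞) ^ r)).toReal ^ 2

theorem wassersteinConst_nonneg (d : ℕ) (r : ℝ) (M : ℝ≥0) : 0 ≤ wassersteinConst d r M := by
  unfold wassersteinConst; positivity

theorem lintegral_wassersteinSq_sq_le_const [NeZero n] (hd : 4 < d) {r : ℝ} (hr : 4 < r) {M : ℝ≥0}
    (hP : ∫⁻ x, ‖x‖ₑ ^ r ∂P ≤ (M : ℝ≥0∞) ^ r) (hind : iIndepFun X μ)
    (hX : ∀ i, HasLaw (X i) P μ) :
    ∫⁻ ω, wassersteinSq (empiricalMeasure fun i => X i ω) P ^ 2 ∂μ ≤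
      ENNReal.ofReal (wassersteinConst d r M * (n : ℝ) ^ (-(4 : ℝ) / d)) := by
  refine (lintegral_wassersteinSq_sq_le hd (by linarith) hP hind hX).trans (le_of_eq ?_)
  conv_rhs => rw [wassersteinConst, mul_right_comm, ENNReal.ofReal_mul (by positivity),
    ENNReal.ofReal_pow ENNReal.toReal_nonneg,
    ENNReal.ofReal_toReal (shellBound_ne_top hr (rpow_moment_ne_top hr M))]

theorem lintegral_e₂_le [NeZero n] (hd : 4 < d) {r : ℝ} (hr : 4 < r) {M : ℝ≥0}
    (hP : ∫⁻ x, ‖x‖ₑ ^ r ∂P ≤ (M : ℝ≥0∞) ^ r) (hind : iIndepFun X μ)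
    (hX : ∀ i, HasLaw (X i) P μ) :
    ∫⁻ ω, e₂ P (fun i => X i ω) ∂μ ≤
      ENNReal.ofReal (wassersteinConst d r M ^ (1 / 2 : ℝ) * (n : ℝ) ^ (-(2 : ℝ) / d)) := by
  have hK := wassersteinConst_nonneg d r M
  calc _ ≤ ∫⁻ ω, wassersteinSq (empiricalMeasure fun i => X i ω) P ∂μ :=
        lintegral_mono fun ω => e₂_le_wassersteinSq P _
    _ ≤ (∫⁻ ω, wassersteinSq (empiricalMeasure fun i => X i ω) P ^ 2 ∂μ) ^ (1 / 2 : ℝ) := by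
        have := ENNReal.lintegral_mul_le_Lp_mul_Lq μ Real.HolderConjugate.two_two
          (aemeasurable_wassersteinSq hr hP hX) (aemeasurable_const (b := (1 : ℝ≥0∞)))
        simpa using this
    _ ≤ ENNReal.ofReal (wassersteinConst d r M * (n : ℝ) ^ (-(4 : ℝ) / d)) ^ (1 / 2 : ℝ) := by
        gcongr
        exact lintegral_wassersteinSq_sq_le_const hd hr hP hind hX
    _ = _ := by
        rw [ENNReal.ofReal_rpow_of_nonneg (by positivity) (by norm_num),
          Real.mul_rpow hK (by positivity), ← Real.rpow_mul (by positivity)]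
        congr 3
        ring

theorem lintegral_e₁_sq_le [NeZero n] {m : ℕ} [NeZero m] {Q : Measure (EuclideanSpace ℝ (Fin d))}
    [IsProbabilityMeasure Q] {Y : Fin m → Ω → EuclideanSpace ℝ (Fin d)}
    (hd : 4 < d) {r : ℝ} (hr : 4 < r) {M : ℝ≥0}
    (hP : ∫⁻ x, ‖x‖ₑ ^ r ∂P ≤ (M : ℝ≥0∞) ^ r) (hQ : ∫⁻ x, ‖x‖ₑ ^ r ∂Q ≤ (M : ℝ≥0∞) ^ r)
    (hindX : iIndepFun X μ) (hX : ∀ i, HasLaw (X i) P μ)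
    (hindY : iIndepFun Y μ) (hY : ∀ j, HasLaw (Y j) Q μ) :
    ∫⁻ ω, e₁ P Q (fun i => X i ω) (fun j => Y j ω) ^ 2 ∂μ ≤
      ENNReal.ofReal (2 * wassersteinConst d r M *
        ((m : ℝ) ^ (-(4 : ℝ) / d) + (n : ℝ) ^ (-(4 : ℝ) / d))) := by
  have hK := wassersteinConst_nonneg d r M
  have hmY := aemeasurable_wassersteinSq hr hQ hY
  calc _ ≤ ∫⁻ ω, 2 * (wassersteinSq (empiricalMeasure fun j => Y j ω) Q ^ 2 +
        wassersteinSq (empiricalMeasure fun i => X i ω) P ^ 2) ∂μ := by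
        refine lintegral_mono fun ω => ?_
        have := ENNReal.rpow_add_le_mul_rpow_add_rpow
          (wassersteinSq (empiricalMeasure fun j => Y j ω) Q)
          (wassersteinSq (empiricalMeasure fun i => X i ω) P) one_le_two
        norm_num at this
        exact this
    _ ≤ 2 * (ENNReal.ofReal (wassersteinConst d r M * (m : ℝ) ^ (-(4 : ℝ) / d)) +
        ENNReal.ofReal (wassersteinConst d r M * (n : ℝ) ^ (-(4 : ℝ) / d))) := by
        rw [lintegral_const_mul' _ _ (by norm_num), lintegral_add_left' (hmY.pow_const 2)]
        gcongr
        · exact lintegral_wassersteinSq_sq_le_const hd hr hQ hindY hY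
        · exact lintegral_wassersteinSq_sq_le_const hd hr hP hindX hX
    _ = _ := by
        rw [← ENNReal.ofReal_add (by positivity) (by positivity), ← mul_add,
          mul_assoc (2 : ℝ), ENNReal.ofReal_mul (p := 2) (by norm_num), ENNReal.ofReal_ofNat]

end Main

end NNTransport

end

theorem mainTheorem8 (d : ℕ) (hd : 4 < d) (r : ℝ) (hr : 4 < r) (M : ℝ≥0) :
    ∃ C : ℝ, 0 < C ∧
      ∀ (P Q : Measure (EuclideanSpace ℝ (Fin d))) [IsProbabilityMeasure P]
        [IsProbabilityMeasure Q] [NullSingletonClass P],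
        ∫⁻ x, ‖x‖ₑ ^ r ∂P ≤ (M : ℝ≥0∞) ^ r → ∫⁻ x, ‖x‖ₑ ^ r ∂Q ≤ (M : ℝ≥0∞) ^ r →
      ∀ (n m : ℕ) [NeZero n] [NeZero m] {Ω : Type*} [MeasurableSpace Ω]
        (μ : Measure Ω) [IsProbabilityMeasure μ]
        (X : Fin n → Ω → EuclideanSpace ℝ (Fin d)) (Y : Fin m → Ω → EuclideanSpace ℝ (Fin d)),
        iIndepFun X μ → (∀ i, HasLaw (X i) P μ) →
        iIndepFun Y μ → (∀ j, HasLaw (Y j) Q μ) →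
        (AEMeasurable (fun ω => NNTransport.e₁ P Q (fun i => X i ω) (fun j => Y j ω)) μ ∧
          ∫⁻ ω, NNTransport.e₁ P Q (fun i => X i ω) (fun j => Y j ω) ^ 2 ∂μ ≤
            ENNReal.ofReal
              (C * ((m : ℝ) ^ (-(4 : ℝ) / (d : ℝ)) + (n : ℝ) ^ (-(4 : ℝ) / (d : ℝ))))) ∧
        (AEMeasurable (fun ω => NNTransport.e₂ P (fun i => X i ω)) μ ∧
          ∫⁻ ω, NNTransport.e₂ P (fun i => X i ω) ∂μ ≤
            ENNReal.ofReal (C * (n : ℝ) ^ (-(2 : ℝ) / (d : ℝ)))) ∧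
        (AEMeasurable (fun ω => NNTransport.e₃ P (fun i => X i ω)) μ ∧
          (2 ≤ n →
            ∫⁻ ω, NNTransport.e₃ P (fun i => X i ω) ^ 2 ∂μ ≤
              ENNReal.ofReal (C * (Real.log (n : ℝ) / (n : ℝ)) ^ 2))) := by
  -- The cones are fixed before `P` and `Q`, so that their number may enter the constant.
  obtain ⟨s, hs⟩ := NNTransport.exists_finset_cone_cover d
  set K := NNTransport.wassersteinConst d r M
  have hK : 0 ≤ K := NNTransport.wassersteinConst_nonneg d r M
  have hK2 : 0 ≤ K ^ (1 / 2 : ℝ) := Real.rpow_nonneg hK _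
  set c : ℝ := 36 * s.card ^ 2 + 3 * s.card
  have hc : 0 ≤ c := by positivity
  -- The sum dominates the constants `2 * K`, `K ^ (1 / 2)` and `c` of the three bounds; the final 1
  -- makes it positive.
  refine ⟨2 * K + K ^ (1 / 2 : ℝ) + c + 1, by positivity, ?_⟩
  intro P Q _ _ _ hP hQ n m _ _ Ω _ μ _ X Y hindX hX hindY hY
  have hm : AEMeasurable (fun ω i => X i ω) μ :=
    aemeasurable_pi_lambda _ fun i => (hX i).aemeasurable
  refine ⟨⟨?_, ?_⟩, ⟨?_, ?_⟩, ?_, fun hn => ?_⟩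
  · exact (NNTransport.aemeasurable_wassersteinSq hr hQ hY).add
      (NNTransport.aemeasurable_wassersteinSq hr hP hX)
  · refine (NNTransport.lintegral_e₁_sq_le hd hr hP hQ hindX hX hindY hY).trans ?_
    refine ENNReal.ofReal_le_ofReal (mul_le_mul_of_nonneg_right ?_ (by positivity))
    linarith
  · exact (NNTransport.measurable_e₂ P).comp_aemeasurable hm
  · refine (NNTransport.lintegral_e₂_le hd hr hP hindX hX).trans ?_
    refine ENNReal.ofReal_le_ofReal (mul_le_mul_of_nonneg_right ?_ (by positivity))
    linarith
  · exact NNTransport.measurable_e₃.comp_aemeasurable hm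
  · rw [NNTransport.lintegral_comp_sample hindX hX (NNTransport.measurable_e₃.pow_const 2)]
    refine (NNTransport.lintegral_e₃_sq_le_log hs hn).trans ?_
    refine ENNReal.ofReal_le_ofReal (mul_le_mul_of_nonneg_right ?_ (by positivity))
    linarith
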